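/- Let $(M^n,g)$ be an $n$-dimensional smooth Riemannian manifold with gradient $\nabla$, Laplacian $\Delta$ and volume measure $dv_g$, let $V=e^{u}$ with $u\in C^\infty(M)$, let $\lambda,\mu\in\mathbb R$ and $\tau=(n+1)\lambda+\mu$. For the affine connection $D=D^{\lambda,\mu}$, $D_XY=\nabla_XY+\lambda\,du(X)Y+\lambda\,du(Y)X+\mu\,g(X,Y)\nabla u$, the affine gradient and the affine Laplacian are $$\nabla^{D}f=V^{\mu-\lambda}\nabla f,\qquad \Delta^{D}f=V^{\mu-\lambda}\bigl[\Delta f+(2\mu+n\lambda)\langle\nabla u,\nabla f\rangle\bigr].$$ Let $\rho\ge 0$ be a continuous function on $M$ which has a locally integrable gradient in the sense of distributions and satisfies $|\nabla^{D}\rho|=1$ almost everywhere. Let $1<p<\infty$, $\alpha\in\mathbb R$, $C>0$, and let $\phi\in C_0^\infty(M\setminus\rho^{-1}\{0\})$. Then the integrals below are of integrable functions, and the following hold, the inequalities for $\Delta^D\rho$ being understood in the sense of distributions on $M\setminus\rho^{-1}\{0\}$. (i) If $\Delta^{D}\rho\le \frac{C}{\rho}V^{\lambda-\mu}$ and $C+\alpha+1<0$,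 then $$\int_M\rho^{\alpha+p}\,|\langle\nabla^{D}\rho,\nabla^{D}\phi\rangle|^{p}\,V^{\tau+\lambda-\mu}\,dv_g\ \ge\ \left(\frac{|C+\alpha+1|}{p}\right)^{p}\int_M\rho^{\alpha}|\phi|^{p}\,V^{\tau+\lambda-\mu}\,dv_g .$$ (ii) If $\Delta^{D}\rho\ge \frac{C}{\rho}V^{\lambda-\mu}$ and $C+\alpha+1>0$, then $$\int_M\rho^{\alpha+p}\,|\langle\nabla^{D}\rho,\nabla^{D}\phi\rangle|^{p}\,V^{\tau+\lambda-\mu}\,dv_g\ \ge\ \left(\frac{C+\alpha+1}{p}\right)^{p}\int_M\rho^{\alpha}|\phi|^{p}\,V^{\tau+\lambda-\mu}\,dv_g .$$ -/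

import Mathlib

open MeasureTheory Set Manifold Bundle
open scoped ContDiff

namespace AffineHardy

noncomputable section

section Volume

theorem measurableSet_target_inter_preimage {n : ℕ} {M : Type*} [TopologicalSpace M]
    [MeasurableSpace M] [BorelSpace M]
    (e : OpenPartialHomeomorph M (EuclideanSpace ℝ (Fin n))) {s : Set M} (hs : MeasurableSet s) :
    MeasurableSet (e.target ∩ e.symm ⁻¹' s) := by
  have h := (continuousOn_iff_continuous_domRestrict.1 e.continuousOn_symm).measurable hs
  have h2 := e.open_target.measurableSet.subtype_image h
  convert h2 using 1
  ext y
  simp [and_comm]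

variable {n : ℕ} {M : Type*} [TopologicalSpace M] [ChartedSpace (EuclideanSpace ℝ (Fin n)) M]
  [RiemannianBundle (fun x : M => TangentSpace (𝓡 n) x)]

/-- The coordinate vector field `∂ᵢ` of the chart `e`, at the point of `M` with coordinates `y`. -/
def coordVector (e : OpenPartialHomeomorph M (EuclideanSpace ℝ (Fin n)))
    (y : EuclideanSpace ℝ (Fin n)) (i : Fin n) : TangentSpace (𝓡 n) (e.symm y) :=
  mfderiv (𝓡 n) (𝓡 n) e.symm y (EuclideanSpace.single i (1 : ℝ) : EuclideanSpace ℝ (Fin n))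

/-- `√(det gᵢⱼ)` in the chart `e`, with `gᵢⱼ = g(∂ᵢ, ∂ⱼ)`. -/
def chartDensity (e : OpenPartialHomeomorph M (EuclideanSpace ℝ (Fin n)))
    (y : EuclideanSpace ℝ (Fin n)) : ℝ :=
  Real.sqrt (Matrix.gram ℝ (coordVector e y)).det

/-- The Riemannian volume of the domain of the chart `e`: the measure `√(det gᵢⱼ) dy`,
carried over to `M`. -/
def chartVolume [MeasurableSpace M] (e : OpenPartialHomeomorph M (EuclideanSpace ℝ (Fin n))) :
    Measure M :=
  ((volume.restrict e.target).withDensity (fun y => ENNReal.ofReal (chartDensity e y))).map e.symm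

variable (n M) in
/-- The Riemannian volume measure `dv_g`: the smallest measure on `M` that is at least
`√(det gᵢⱼ) dy` in every chart. By `riemannianVolume_restrict` it is equal to
`√(det gᵢⱼ) dy` in every chart. -/
def riemannianVolume [MeasurableSpace M] : Measure M :=
  ⨆ e ∈ atlas (EuclideanSpace ℝ (Fin n)) M, chartVolume e


theorem chartVolume_apply [MeasurableSpace M] [BorelSpace M]
    (e : OpenPartialHomeomorph M (EuclideanSpace ℝ (Fin n))) {s : Set M} (hs : MeasurableSet s) :
    chartVolume e s =
      ∫⁻ y in e.target ∩ e.symm ⁻¹' s, ENNReal.ofReal (chartDensity e y) := by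
  have hm : AEMeasurable e.symm (volume.restrict e.target) :=
    e.continuousOn_symm.aemeasurable e.open_target.measurableSet
  have hm' := hm.mono_ac
    (withDensity_absolutelyContinuous _ (fun y => ENNReal.ofReal (chartDensity e y)))
  rw [chartVolume, Measure.map_apply_of_aemeasurable hm' hs, withDensity_apply',
    Measure.restrict_restrict' e.open_target.measurableSet, inter_comm]

/-- The metric at `p`, read on the model space. -/
def metricAt (p : M) (v w : EuclideanSpace ℝ (Fin n)) : ℝ :=
  inner ℝ (show TangentSpace (𝓡 n) p from v) (show TangentSpace (𝓡 n) p from w)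

theorem metricAt_sum (p : M) (c d : Fin n → ℝ) (v w : Fin n → EuclideanSpace ℝ (Fin n)) :
    metricAt p (∑ k, c k • v k) (∑ l, d l • w l) = ∑ k, ∑ l, c k * d l * metricAt p (v k) (w l) := by
  have h := sum_inner (𝕜 := ℝ) (E := TangentSpace (𝓡 n) p) Finset.univ (fun k => c k • v k) (∑ l, d l • w l)
  refine h.trans (Finset.sum_congr rfl fun k _ => ?_)
  refine (inner_sum (𝕜 := ℝ) (E := TangentSpace (𝓡 n) p) Finset.univ (fun l => d l • w l) (c k • v k)).trans
    (Finset.sum_congr rfl fun l _ => ?_)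
  have h1 := real_inner_smul_left (F := TangentSpace (𝓡 n) p) (v k) (d l • w l) (c k)
  have h2 := real_inner_smul_right (F := TangentSpace (𝓡 n) p) (v k) (w l) (d l)
  exact h1.trans ((congrArg (c k * ·) h2).trans (mul_assoc _ _ _).symm)

theorem chartDensity_eq [IsManifold (𝓡 n) ∞ M]
    {e e' : OpenPartialHomeomorph M (EuclideanSpace ℝ (Fin n))}
    (he : e ∈ atlas (EuclideanSpace ℝ (Fin n)) M) (he' : e' ∈ atlas (EuclideanSpace ℝ (Fin n)) M)
    {y : EuclideanSpace ℝ (Fin n)} (hy : y ∈ e.target) (hy' : e.symm y ∈ e'.source) :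
    DifferentiableAt ℝ (e' ∘ e.symm) y ∧ chartDensity e y =
      |(fderiv ℝ (e' ∘ e.symm) y).det| * chartDensity e' (e' (e.symm y)) := by
  have : IsManifold (𝓡 n) 1 M := IsManifold.of_le (n := ∞) (by simp)
  have d1 := mdifferentiableAt_atlas_symm (I := 𝓡 n) he hy
  have d2 := mdifferentiableAt_atlas (I := 𝓡 n) he' hy'
  have d3 := mdifferentiableAt_atlas_symm (I := 𝓡 n) he' (e'.map_source hy')
  have d4 : MDifferentiableAt (𝓡 n) (𝓡 n) (e' ∘ e.symm) y := d2.comp y d1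
  have d5 : DifferentiableAt ℝ (e' ∘ e.symm) y := d4.differentiableAt
  refine ⟨d5, ?_⟩
  have hev : e.symm =ᶠ[nhds y] e'.symm ∘ (e' ∘ e.symm) := by
    have := (e.continuousAt_symm hy).preimage_mem_nhds (e'.open_source.mem_nhds hy')
    filter_upwards [this] with z hz
    exact (e'.left_inv hz).symm
  have hA : (mfderiv (𝓡 n) (𝓡 n) e.symm y : EuclideanSpace ℝ (Fin n) →L[ℝ] EuclideanSpace ℝ (Fin n))
      = (mfderiv (𝓡 n) (𝓡 n) e'.symm (e' (e.symm y)) :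
          EuclideanSpace ℝ (Fin n) →L[ℝ] EuclideanSpace ℝ (Fin n)).comp (fderiv ℝ (e' ∘ e.symm) y) := by
    have h1 := hev.mfderiv_eq (I := 𝓡 n) (I' := 𝓡 n)
    have h2 := mfderiv_comp y (I := 𝓡 n) (I' := 𝓡 n) (I'' := 𝓡 n) (f := e' ∘ e.symm) (g := e'.symm) d3 d4
    rw [← mfderiv_eq_fderiv]
    exact h1.trans h2
  set L := fderiv ℝ (e' ∘ e.symm) y with hL
  set B : EuclideanSpace ℝ (Fin n) →L[ℝ] EuclideanSpace ℝ (Fin n) :=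
    mfderiv (𝓡 n) (𝓡 n) e'.symm (e' (e.symm y)) with hB
  let b := (EuclideanSpace.basisFun (Fin n) ℝ).toBasis
  let P : Matrix (Fin n) (Fin n) ℝ := LinearMap.toMatrix b b L.toLinearMap
  have hP : ∀ i, L (EuclideanSpace.single i 1) = ∑ k, P k i • EuclideanSpace.single k (1:ℝ) := by
    intro i
    have := (b.sum_repr (L (b i))).symm
    simpa [P, LinearMap.toMatrix_apply, b] using this
  have hcv : ∀ i, (coordVector e y i : EuclideanSpace ℝ (Fin n)) =
      ∑ k, P k i • B (EuclideanSpace.single k (1:ℝ)) := by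
    intro i
    have : (coordVector e y i : EuclideanSpace ℝ (Fin n)) = B (L (EuclideanSpace.single i 1)) :=
      congrArg (fun T : EuclideanSpace ℝ (Fin n) →L[ℝ] EuclideanSpace ℝ (Fin n) =>
        T (EuclideanSpace.single i 1)) hA
    rw [this, hP, map_sum]
    exact Finset.sum_congr rfl fun k _ => B.map_smul _ _
  have hgram : Matrix.gram ℝ (coordVector e y) =
      P.transpose * Matrix.gram ℝ (coordVector e' (e' (e.symm y))) * P := by
    ext i j
    have hl : Matrix.gram ℝ (coordVector e y) i j =
        metricAt (e.symm y) (coordVector e y i) (coordVector e y j) := rfl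
    have hr : ∀ k l, Matrix.gram ℝ (coordVector e' (e' (e.symm y))) k l =
        metricAt (e.symm y) (B (EuclideanSpace.single k (1:ℝ))) (B (EuclideanSpace.single l (1:ℝ))) := by
      intro k l
      have : Matrix.gram ℝ (coordVector e' (e' (e.symm y))) k l =
        metricAt (e'.symm (e' (e.symm y))) (B (EuclideanSpace.single k (1:ℝ)))
          (B (EuclideanSpace.single l (1:ℝ))) := rfl
      rw [this, e'.left_inv hy']
    rw [hl, hcv, hcv, metricAt_sum, Matrix.mul_apply, Finset.sum_comm]
    refine Finset.sum_congr rfl fun l _ => ?_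
    rw [Matrix.mul_apply, Finset.sum_mul]
    refine Finset.sum_congr rfl fun k _ => ?_
    rw [hr, Matrix.transpose_apply]
    ring
  have hdet : P.det = L.det := LinearMap.det_toMatrix b L.toLinearMap
  rw [chartDensity, chartDensity, hgram, Matrix.det_mul, Matrix.det_mul, Matrix.det_transpose, hdet,
    mul_right_comm, Real.sqrt_mul (mul_self_nonneg _), Real.sqrt_mul_self_eq_abs]

theorem chartVolume_congr [IsManifold (𝓡 n) ∞ M] [MeasurableSpace M] [BorelSpace M]
    {e e' : OpenPartialHomeomorph M (EuclideanSpace ℝ (Fin n))}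
    (he : e ∈ atlas (EuclideanSpace ℝ (Fin n)) M) (he' : e' ∈ atlas (EuclideanSpace ℝ (Fin n)) M)
    {s : Set M} (hs : MeasurableSet s) (h : s ⊆ e.source) (h' : s ⊆ e'.source) :
    chartVolume e s = chartVolume e' s := by
  rw [chartVolume_apply e hs, chartVolume_apply e' hs]
  have himg : e'.target ∩ e'.symm ⁻¹' s = (e' ∘ e.symm) '' (e.target ∩ e.symm ⁻¹' s) := by
    ext z
    constructor
    · rintro ⟨hz, hzs⟩
      have hzs : e'.symm z ∈ s := hzs
      exact ⟨e (e'.symm z), ⟨e.map_source (h hzs), by simpa [e.left_inv (h hzs)] using hzs⟩,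
        by simp [e.left_inv (h hzs), e'.right_inv hz]⟩
    · rintro ⟨y, ⟨hy, hys⟩, rfl⟩
      have hys : e.symm y ∈ s := hys
      exact ⟨e'.map_source (h' hys), by simpa [e'.left_inv (h' hys)] using hys⟩
  have hinj : InjOn (e' ∘ e.symm) (e.target ∩ e.symm ⁻¹' s) := by
    rintro y ⟨hy, hys⟩ z ⟨hz, hzs⟩ hyz
    exact e.symm.injOn hy hz (e'.injOn (h' hys) (h' hzs) hyz)
  rw [himg, lintegral_image_eq_lintegral_abs_det_fderiv_mul volume
    (measurableSet_target_inter_preimage e hs)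
    (fun y hy => (chartDensity_eq he he' hy.1 (h' hy.2)).1.hasFDerivAt.hasFDerivWithinAt) hinj]
  refine setLIntegral_congr_fun (measurableSet_target_inter_preimage e hs) fun y hy => ?_
  rw [(chartDensity_eq he he' hy.1 (h' hy.2)).2, ENNReal.ofReal_mul (abs_nonneg _)]
  rfl

/-- In every chart, the Riemannian volume measure is `√(det gᵢⱼ) dy`. -/
theorem riemannianVolume_restrict [IsManifold (𝓡 n) ∞ M] [SecondCountableTopology M]
    [MeasurableSpace M] [BorelSpace M] {e : OpenPartialHomeomorph M (EuclideanSpace ℝ (Fin n))}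
    (he : e ∈ atlas (EuclideanSpace ℝ (Fin n)) M) :
    (riemannianVolume n M).restrict e.source = chartVolume e := by
  have hsupp : ∀ e : OpenPartialHomeomorph M (EuclideanSpace ℝ (Fin n)),
      (chartVolume e).restrict e.source = chartVolume e := by
    intro e
    ext s hs
    rw [Measure.restrict_apply hs, chartVolume_apply e hs,
      chartVolume_apply e (hs.inter e.open_source.measurableSet)]
    congr 2
    ext y
    simp +contextual [e.map_target]
  obtain ⟨t, ht, htU⟩ := TopologicalSpace.countable_cover_nhds
    (f := fun x : M => (chartAt (EuclideanSpace ℝ (Fin n)) x).source)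
    (fun x => chart_source_mem_nhds _ x)
  have : Countable t := ht.to_subtype
  let c : t → OpenPartialHomeomorph M (EuclideanSpace ℝ (Fin n)) := fun x => chartAt _ (x : M)
  have hc : ∀ x, c x ∈ atlas (EuclideanSpace ℝ (Fin n)) M := fun x => chart_mem_atlas _ _
  obtain ⟨D, hDsub, hDU, hDm, hDd⟩ : ∃ D : t → Set M, (∀ x, D x ⊆ (c x).source) ∧
      (⋃ x, D x) = univ ∧ (∀ x, MeasurableSet (D x)) ∧ Pairwise (Function.onFun Disjoint D) := by
    obtain ⟨f, hf⟩ := exists_injective_nat t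
    refine ⟨fun x => (c x).source \ ⋃ y : {y // f y < f x}, (c y).source, fun x => sdiff_subset, ?_,
      fun x => (c x).open_source.measurableSet.diff
        (MeasurableSet.iUnion fun y => (c y).open_source.measurableSet), ?_⟩
    · refine eq_univ_of_forall fun p => ?_
      have hp : ∃ k, ∃ x, f x = k ∧ p ∈ (c x).source := by
        have : p ∈ ⋃ x ∈ t, (chartAt (EuclideanSpace ℝ (Fin n)) x).source := htU ▸ mem_univ p
        obtain ⟨x, hx, hpx⟩ := mem_iUnion₂.1 this
        exact ⟨_, ⟨x, hx⟩, rfl, hpx⟩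
      classical
      obtain ⟨x, hx, hpx⟩ := Nat.find_spec hp
      refine mem_iUnion.2 ⟨x, hpx, fun hmem => ?_⟩
      obtain ⟨y, hy⟩ := mem_iUnion.1 hmem
      exact Nat.find_min hp (hx ▸ y.2) ⟨y, rfl, hy⟩
    · intro x y hxy
      refine Set.disjoint_left.2 fun p hp hq => ?_
      rcases lt_or_gt_of_ne (hf.ne hxy) with h | h
      · exact hq.2 (mem_iUnion.2 ⟨⟨x, h⟩, hp.1⟩)
      · exact hp.2 (mem_iUnion.2 ⟨⟨y, h⟩, hq.1⟩)
  let m : Measure M := Measure.sum fun x => (chartVolume (c x)).restrict (D x)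
  have key : ∀ e' ∈ atlas (EuclideanSpace ℝ (Fin n)) M, m.restrict e'.source = chartVolume e' := by
    intro e' he'
    ext s hs
    have hse := hs.inter e'.open_source.measurableSet
    rw [Measure.restrict_apply hs, Measure.sum_apply _ hse]
    have : ∀ x, (chartVolume (c x)).restrict (D x) (s ∩ e'.source) =
        chartVolume e' (s ∩ e'.source ∩ D x) := by
      intro x
      rw [Measure.restrict_apply hse]
      exact chartVolume_congr (hc x) he' (hse.inter (hDm x)) (inter_subset_right.trans (hDsub x))
        (inter_subset_left.trans inter_subset_right)
    simp_rw [this]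
    rw [← measure_iUnion (fun i j hij => (hDd hij).mono inter_subset_right inter_subset_right)
      (fun x => hse.inter (hDm x)), ← inter_iUnion, hDU, inter_univ]
    conv_rhs => rw [← hsupp e', Measure.restrict_apply hs]
  have hle : riemannianVolume n M ≤ m :=
    iSup₂_le fun e' he' => (key e' he').symm.le.trans Measure.restrict_le_self
  refine le_antisymm ((Measure.restrict_mono le_rfl hle).trans (key e he).le) ?_
  rw [← hsupp e]
  exact Measure.restrict_mono le_rfl (le_iSup₂_of_le (f := fun e (_ : e ∈ atlas _ M) => chartVolume e) e he le_rfl)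

end Volume

section Gradient

variable {n : ℕ} {M : Type*} [TopologicalSpace M] [ChartedSpace (EuclideanSpace ℝ (Fin n)) M]
  [RiemannianBundle (fun x : M => TangentSpace (𝓡 n) x)]

instance instFiniteDimensionalTangent (x : M) : FiniteDimensional ℝ (TangentSpace (𝓡 n) x) :=
  inferInstanceAs (FiniteDimensional ℝ (EuclideanSpace ℝ (Fin n)))

instance instCompleteSpaceTangent (x : M) : CompleteSpace (TangentSpace (𝓡 n) x) :=
  FiniteDimensional.complete ℝ _

/-- The Riemannian gradient `∇f` of a differentiable function: `⟨∇f, v⟩ = df(v)`. -/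
def gradient (f : M → ℝ) (x : M) : TangentSpace (𝓡 n) x :=
  (InnerProductSpace.toDual ℝ (TangentSpace (𝓡 n) x)).symm (mfderiv (𝓡 n) 𝓘(ℝ, ℝ) f x)

/-- The vector field `G` is the gradient of `f` in the sense of distributions: in every chart,
`f` and the functions `⟨G, ∂ᵢ⟩` are locally integrable, and `⟨G, ∂ᵢ⟩` is the distributional
partial derivative `∂ᵢ f`. -/
structure HasWeakGradient (f : M → ℝ) (G : (x : M) → TangentSpace (𝓡 n) x) : Prop where
  locallyIntegrableOn : ∀ e ∈ atlas (EuclideanSpace ℝ (Fin n)) M,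
    LocallyIntegrableOn (fun y => f (e.symm y)) e.target
  locallyIntegrableOn_grad : ∀ e ∈ atlas (EuclideanSpace ℝ (Fin n)) M, ∀ i : Fin n,
    LocallyIntegrableOn (fun y => (inner ℝ (G (e.symm y)) (coordVector e y i) : ℝ)) e.target
  integral_eq : ∀ e ∈ atlas (EuclideanSpace ℝ (Fin n)) M, ∀ i : Fin n,
    ∀ ψ : EuclideanSpace ℝ (Fin n) → ℝ, ContDiff ℝ ∞ ψ → HasCompactSupport ψ →
      tsupport ψ ⊆ e.target →
      ∫ y in e.target, f (e.symm y) * fderiv ℝ ψ y (EuclideanSpace.single i 1) =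
        -∫ y in e.target, inner ℝ (G (e.symm y)) (coordVector e y i) * ψ y

/-- `ψ ∈ C₀^∞(M ∖ ρ⁻¹{0})`. -/
structure IsTestFunction (n : ℕ) {M : Type*} [TopologicalSpace M]
    [ChartedSpace (EuclideanSpace ℝ (Fin n)) M] (ρ ψ : M → ℝ) : Prop where
  smooth : ContMDiff (𝓡 n) 𝓘(ℝ, ℝ) ∞ ψ
  compact : HasCompactSupport ψ
  support : tsupport ψ ⊆ {x | ρ x ≠ 0}

/-- The affine gradient `V^(μ-λ) G`, with `V = e^u`, of a function with gradient `G`. -/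
def affineGradient (u : M → ℝ) (lam mu : ℝ) (G : (x : M) → TangentSpace (𝓡 n) x) (x : M) :
    TangentSpace (𝓡 n) x :=
  (Real.exp (u x) ^ (mu - lam)) • G x

variable [MeasurableSpace M]

/-- The distributional Laplacian `Δf` of a function with weak gradient `G`, paired with the test
function `ψ`: `-∫ ⟨G, ∇ψ⟩ dv_g`. -/
def distLaplacian (G : (x : M) → TangentSpace (𝓡 n) x) (ψ : M → ℝ) : ℝ :=
  -∫ x, inner ℝ (G x) (gradient ψ x) ∂(riemannianVolume n M)

/-- The affine Laplacian `V^(μ-λ) (Δf + (2μ + nλ) ⟨∇u, ∇f⟩)`, `V = e^u`, as a distribution, of a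
function `f` with weak gradient `G`, paired with the test function `ψ`. The smooth
factor `V^(μ-λ)` is moved onto the test function, as usual for distributions. -/
def affineLaplacian (u : M → ℝ) (lam mu : ℝ) (G : (x : M) → TangentSpace (𝓡 n) x)
    (ψ : M → ℝ) : ℝ :=
  distLaplacian G (fun x => Real.exp (u x) ^ (mu - lam) * ψ x) +
    ∫ x, (2 * mu + n * lam) * inner ℝ (gradient u x) (G x) * (Real.exp (u x) ^ (mu - lam) * ψ x)
      ∂(riemannianVolume n M)

/-- `Δ^D ρ ≤ h` on `M ∖ ρ⁻¹{0}` in the sense of distributions. -/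
def AffineLaplacianLE (u : M → ℝ) (lam mu : ℝ) (ρ : M → ℝ)
    (G : (x : M) → TangentSpace (𝓡 n) x) (h : M → ℝ) : Prop :=
  ∀ ψ : M → ℝ, IsTestFunction n ρ ψ → (∀ x, 0 ≤ ψ x) →
    affineLaplacian u lam mu G ψ ≤ ∫ x, h x * ψ x ∂(riemannianVolume n M)

/-- `Δ^D ρ ≥ h` on `M ∖ ρ⁻¹{0}` in the sense of distributions. -/
def AffineLaplacianGE (u : M → ℝ) (lam mu : ℝ) (ρ : M → ℝ)
    (G : (x : M) → TangentSpace (𝓡 n) x) (h : M → ℝ) : Prop :=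
  ∀ ψ : M → ℝ, IsTestFunction n ρ ψ → (∀ x, 0 ≤ ψ x) →
    ∫ x, h x * ψ x ∂(riemannianVolume n M) ≤ affineLaplacian u lam mu G ψ

end Gradient

end

end AffineHardy

namespace AffineHardy

/-! ### Mollifying a function with locally bounded weak derivatives on an open set of Euclidean
space. -/

section Mollification

open Filter Topology ContinuousLinearMap
open scoped Convolution

variable {n : ℕ}

local notation "𝔼" => EuclideanSpace ℝ (Fin n)

/-! Put `m = λ - μ`, `a = τ + λ - μ`, `b = τ + μ - λ = a - 2m`; then `|G| = V^m` almost everywhere.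
Since `2μ + nλ = b`, the weight `V^τ` puts the affine Laplacian in divergence form
(`affineLaplacian_exp_rpow_mul`), so the hypothesis on `Δ^D ρ` gives a sign to `∫ (C ρ⁻¹ V^a ζ + V^b
⟨G, ∇ζ⟩)` for every test function `ζ ≥ 0` (`hardyForm_zero_eq`).

Replacing `ζ` by `ρ^β ζ` produces the extra term `β ρ^(β-1) V^b |G|² ζ = β ρ^(β-1) V^a ζ`, so `C`
becomes `C + β` (`hardyForm_nonneg`). With `β = α + 1` and `ζ = |φ|^p` this yields, for `c = C + α +
1`, `|c| ∫ ρ^α V^a |φ|^p ≤ p ∫ ρ^(α+1) V^b |φ|^(p-1) |⟨G, ∇φ⟩|`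
(`abs_mul_integral_le_of_hardyForm_nonneg`). Young's inequality with parameter `|c|/p` bounds the
right side by a multiple of the left side plus the gradient integral, and the constant comes out as
`(|c|/p)^p` (`hardy_of_hardyForm_nonneg`).

The analytic work is that neither `ρ^β ζ` nor `|φ|^p` need be smooth. The first is handled by a
partition of unity and mollification of `ρ` in charts (`exists_approx_in_chart`), the second by
`smoothPow`. Both limits are dominated convergence on a compact set where `ρ > 0`. -/

theorem integral_normed_sub (φ : ContDiffBump (0 : 𝔼)) (y : 𝔼) :
    ∫ t, φ.normed volume (y - t) = 1 := by
  rw [integral_sub_left_eq_self (fun t => φ.normed volume t) volume y, φ.integral_normed]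

theorem normed_sub_eq_zero (φ : ContDiffBump (0 : 𝔼)) {y t : 𝔼} {L : Set 𝔼}
    (hL : Metric.closedBall y φ.rOut ⊆ L) (ht : t ∉ L) : φ.normed volume (y - t) = 0 := by
  by_contra h
  refine ht (hL ?_)
  have : y - t ∈ Function.support (φ.normed volume) := h
  rw [φ.support_normed_eq] at this
  rw [Metric.mem_closedBall, dist_comm, dist_eq_norm]
  exact (mem_ball_zero_iff.1 this).le

theorem integrable_mul_normed_sub (φ : ContDiffBump (0 : 𝔼)) {h : 𝔼 → ℝ}
    (hh : LocallyIntegrable h) (y : 𝔼) : Integrable fun t => h t * φ.normed volume (y - t) :=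
  φ.hasCompactSupport_normed.convolutionExists_right (lsmul ℝ ℝ) hh φ.continuous_normed y

/-- The kernel is a probability density carried by a ball inside `L`, so mollification is an average
of values on `L` and obeys the same essential bounds. -/
theorem integral_mul_normed_sub_le (φ : ContDiffBump (0 : 𝔼)) {h : 𝔼 → ℝ}
    (hh : LocallyIntegrable h) {y : 𝔼} {L : Set 𝔼} (hLm : MeasurableSet L)
    (hL : Metric.closedBall y φ.rOut ⊆ L) {b : ℝ} (hb : ∀ᵐ t ∂volume.restrict L, h t ≤ b) :
    ∫ t, h t * φ.normed volume (y - t) ≤ b := by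
  have hi : Integrable fun t => b * φ.normed volume (y - t) :=
    (φ.integrable_normed.comp_sub_left y).const_mul b
  calc ∫ t, h t * φ.normed volume (y - t) ≤ ∫ t, b * φ.normed volume (y - t) := by
        refine integral_mono_ae (integrable_mul_normed_sub φ hh y) hi ?_
        filter_upwards [(ae_restrict_iff' hLm).1 hb] with t ht
        by_cases htL : t ∈ L
        · exact mul_le_mul_of_nonneg_right (ht htL) (φ.nonneg_normed _)
        · simp [normed_sub_eq_zero φ hL htL]
    _ = b := by rw [integral_const_mul, integral_normed_sub, mul_one]

theorem le_integral_mul_normed_sub (φ : ContDiffBump (0 : 𝔼)) {h : 𝔼 → ℝ}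
    (hh : LocallyIntegrable h) {y : 𝔼} {L : Set 𝔼} (hLm : MeasurableSet L)
    (hL : Metric.closedBall y φ.rOut ⊆ L) {a : ℝ} (ha : ∀ᵐ t ∂volume.restrict L, a ≤ h t) :
    a ≤ ∫ t, h t * φ.normed volume (y - t) := by
  have := integral_mul_normed_sub_le φ (h := fun t => -h t) hh.neg hLm hL (b := -a)
    (ha.mono fun t ht => neg_le_neg ht)
  simp only [neg_mul, integral_neg] at this
  linarith

/-- Differentiating a mollification puts the distributional derivative under the integral. -/
theorem fderiv_convolution_normed (φ : ContDiffBump (0 : 𝔼)) {Ω L : Set 𝔼} {f g : 𝔼 → ℝ} {v : 𝔼}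
    (hLΩ : L ⊆ Ω) (hΩ : MeasurableSet Ω)
    (hfL : LocallyIntegrable (L.indicator f))
    (hw : ∀ ψ : 𝔼 → ℝ, ContDiff ℝ ∞ ψ → HasCompactSupport ψ → tsupport ψ ⊆ Ω →
      ∫ y in Ω, f y * fderiv ℝ ψ y v = -∫ y in Ω, g y * ψ y)
    {y : 𝔼} (hL : Metric.closedBall y φ.rOut ⊆ L) :
    fderiv ℝ (L.indicator f ⋆[lsmul ℝ ℝ, volume] φ.normed volume) y v =
      ∫ t, L.indicator g t * φ.normed volume (y - t) := by
  have hs : ContDiff ℝ ∞ (φ.normed volume) := φ.contDiff_normed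
  have hd := φ.hasCompactSupport_normed.hasFDerivAt_convolution_right (lsmul ℝ ℝ) (μ := volume) hfL
    (hs.of_le (by simp)) y
  rw [hd.fderiv, convolution_precompR_apply (lsmul ℝ ℝ) hfL (φ.hasCompactSupport_normed.fderiv ℝ)
    (hs.continuous_fderiv (by simp))]
  have hψs : ContDiff ℝ ∞ fun t : 𝔼 => φ.normed volume (y - t) :=
    hs.comp (contDiff_const.sub contDiff_id)
  have hsub : Function.support (fun t : 𝔼 => φ.normed volume (y - t)) ⊆
      Metric.closedBall y φ.rOut := by
    intro t ht
    by_contra h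
    exact ht (normed_sub_eq_zero φ subset_rfl h)
  have hts : tsupport (fun t : 𝔼 => φ.normed volume (y - t)) ⊆ Metric.closedBall y φ.rOut :=
    closure_minimal hsub Metric.isClosed_closedBall
  have hψc : HasCompactSupport fun t : 𝔼 => φ.normed volume (y - t) :=
    (isCompact_closedBall y φ.rOut).of_isClosed_subset (isClosed_tsupport _) hts
  have hder : ∀ t, fderiv ℝ (fun t : 𝔼 => φ.normed volume (y - t)) t v =
      -fderiv ℝ (φ.normed volume) (y - t) v := by
    intro t
    have h1 : HasFDerivAt (φ.normed volume) (fderiv ℝ (φ.normed volume) (y - t)) (y - t) :=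
      (hs.differentiable (by simp) _).hasFDerivAt
    have h2 := h1.comp t ((hasFDerivAt_const y t).sub (hasFDerivAt_id t))
    have h3 : fderiv ℝ (fun t : 𝔼 => φ.normed volume (y - t)) t = _ := h2.fderiv
    rw [h3]
    simp
  -- The reflected kernel `t ↦ φ(y - t)` is itself an admissible test function; the sign from the
  -- reflection cancels the sign of the weak derivative.
  have key := hw _ hψs hψc (hts.trans (hL.trans hLΩ))
  simp only [hder, mul_neg, integral_neg, neg_inj] at key
  -- Kernel and derivative both vanish off `L`, so the indicators of `L` and of `Ω` are
  -- interchangeable below.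
  have hz : ∀ t ∉ L, fderiv ℝ (φ.normed volume) (y - t) v = 0 := by
    intro t ht
    have : t ∉ tsupport (fun t : 𝔼 => φ.normed volume (y - t)) := fun h => ht (hL (hts h))
    have h2 := fderiv_of_notMem_tsupport (𝕜 := ℝ) this
    have h3 := hder t
    rw [h2] at h3
    simpa using h3.symm
  rw [convolution_def]
  rw [← integral_indicator hΩ, ← integral_indicator hΩ] at key
  convert key using 1
  · refine integral_congr_ae (ae_of_all _ fun t => ?_)
    by_cases ht : t ∈ L
    · simp [ht, hLΩ ht]
    · by_cases ht' : t ∈ Ω <;> simp [ht, ht', hz t ht]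
  · refine integral_congr_ae (ae_of_all _ fun t => ?_)
    by_cases ht : t ∈ L
    · simp [ht, hLΩ ht]
    · by_cases ht' : t ∈ Ω <;> simp [ht, ht', normed_sub_eq_zero φ hL ht]

/-- Smooth approximation, near a compact set `K`, of a positive continuous function with locally
bounded weak derivatives. -/
theorem exists_smooth_approx {Ω K : Set 𝔼} (hΩ : IsOpen Ω) (hK : IsCompact K) (hKΩ : K ⊆ Ω)
    {f : 𝔼 → ℝ} (hf : ContinuousOn f Ω) (hpos : ∀ y ∈ K, 0 < f y) {g : Fin n → 𝔼 → ℝ}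
    (hg : ∀ i, LocallyIntegrableOn (g i) Ω)
    (hgb : ∀ L, IsCompact L → L ⊆ Ω → ∃ B, ∀ i, ∀ᵐ y ∂volume.restrict L, |g i y| ≤ B)
    (hw : ∀ i, ∀ ψ : 𝔼 → ℝ, ContDiff ℝ ∞ ψ → HasCompactSupport ψ → tsupport ψ ⊆ Ω →
      ∫ y in Ω, f y * fderiv ℝ ψ y (EuclideanSpace.single i 1) = -∫ y in Ω, g i y * ψ y) :
    ∃ (r : ℕ → 𝔼 → ℝ) (a b B : ℝ), 0 < a ∧ (∀ k, ContDiff ℝ ∞ (r k)) ∧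
      (∀ k, ∀ y ∈ K, a ≤ r k y ∧ r k y ≤ b) ∧
      (∀ k i, ∀ y ∈ K, |fderiv ℝ (r k) y (EuclideanSpace.single i 1)| ≤ B) ∧
      ∀ᵐ y ∂volume.restrict K, Tendsto (fun k => r k y) atTop (𝓝 (f y)) ∧
        ∀ i, Tendsto (fun k => fderiv ℝ (r k) y (EuclideanSpace.single i 1)) atTop (𝓝 (g i y)) := by
  -- The thickening `L` of `K` is taken where `f > 0`, so `f` has a positive lower bound on `L`,
  -- which averages over small balls inherit.
  have hopen : IsOpen (Ω ∩ f ⁻¹' Ioi 0) := hf.isOpen_inter_preimage hΩ isOpen_Ioi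
  obtain ⟨δ, hδ, hsub⟩ := hK.exists_cthickening_subset_open hopen fun y hy => ⟨hKΩ hy, hpos y hy⟩
  set L := Metric.cthickening δ K with hLdef
  have hLc : IsCompact L := hK.cthickening
  have hLm : MeasurableSet L := hLc.isClosed.measurableSet
  have hLΩ : L ⊆ Ω := fun y hy => (hsub hy).1
  have hKL : K ⊆ L := Metric.self_subset_cthickening K
  have hfL : ContinuousOn f L := hf.mono hLΩ
  have hfi : Integrable (L.indicator f) := (integrable_indicator_iff hLm).2 (hfL.integrableOn_compact hLc)
  have hgi : ∀ i, Integrable (L.indicator (g i)) := fun i =>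
    (integrable_indicator_iff hLm).2 ((hg i).integrableOn_compact_subset hLΩ hLc)
  obtain ⟨b, hb⟩ : ∃ b, ∀ y ∈ L, f y ≤ b := by
    obtain ⟨b, hb⟩ := hLc.bddAbove_image hfL
    exact ⟨b, fun y hy => hb ⟨y, hy, rfl⟩⟩
  obtain ⟨a, ha0, ha⟩ : ∃ a, 0 < a ∧ ∀ y ∈ L, a ≤ f y := by
    rcases L.eq_empty_or_nonempty with h | h
    · exact ⟨1, one_pos, by simp [h]⟩
    · obtain ⟨y, hy, hmin⟩ := hLc.exists_isMinOn h hfL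
      exact ⟨f y, (hsub hy).2, fun z hz => hmin hz⟩
  obtain ⟨B, hB⟩ := hgb L hLc hLΩ
  -- Outer radii at most `δ` keep the balls around `K` inside `L`; the fixed ratio 2 of the radii is
  -- what Lebesgue differentiation requires for almost everywhere convergence.
  let φ : ℕ → ContDiffBump (0 : 𝔼) := fun k =>
    ⟨δ / (k + 1) / 2, δ / (k + 1), by positivity, half_lt_self (by positivity)⟩
  have hφ : ∀ k, (φ k).rOut = δ / (k + 1) := fun k => rfl
  have hball : ∀ k, ∀ y ∈ K, Metric.closedBall y (φ k).rOut ⊆ L := by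
    intro k y hy
    refine (Metric.closedBall_subset_closedBall ?_).trans
      (Metric.closedBall_subset_cthickening hy δ)
    rw [hφ]
    exact div_le_self hδ.le (by linarith [k.cast_nonneg (α := ℝ)])
  have hlim : Tendsto (fun k => (φ k).rOut) atTop (𝓝 0) :=
    tendsto_const_nhds.div_atTop (tendsto_natCast_atTop_atTop.atTop_add tendsto_const_nhds)
  have hrat : ∀ᶠ k in atTop, (φ k).rOut ≤ 2 * (φ k).rIn :=
    Eventually.of_forall fun k => (by simp [φ]; linarith)
  have hae : ∀ {h : 𝔼 → ℝ}, Integrable h → ∀ᵐ y,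
      Tendsto (fun k => ∫ t, h t * (φ k).normed volume (y - t)) atTop (𝓝 (h y)) := by
    intro h hh
    filter_upwards [ContDiffBump.ae_convolution_tendsto_right_of_locallyIntegrable (μ := volume)
      hlim hrat hh.locallyIntegrable] with y hy
    refine hy.congr fun k => ?_
    rw [convolution_eq_swap]
    exact integral_congr_ae (ae_of_all _ fun t => by simp [mul_comm])
  have hder : ∀ k i, ∀ y ∈ K, fderiv ℝ (L.indicator f ⋆[lsmul ℝ ℝ, volume] (φ k).normed volume) y
      (EuclideanSpace.single i 1) = ∫ t, L.indicator (g i) t * (φ k).normed volume (y - t) :=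
    fun k i y hy => fderiv_convolution_normed (φ k) hLΩ hΩ.measurableSet hfi.locallyIntegrable
      (hw i) (hball k y hy)
  refine ⟨fun k => L.indicator f ⋆[lsmul ℝ ℝ, volume] (φ k).normed volume, a, b, B, ha0,
    fun k => (φ k).hasCompactSupport_normed.contDiff_convolution_right _ hfi.locallyIntegrable
      (φ k).contDiff_normed, fun k y hy => ⟨?_, ?_⟩, fun k i y hy => ?_, ?_⟩
  · refine le_integral_mul_normed_sub (φ k) hfi.locallyIntegrable hLm (hball k y hy) ?_
    filter_upwards [ae_restrict_mem hLm] with t ht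
    simpa [ht] using ha t ht
  · refine integral_mul_normed_sub_le (φ k) hfi.locallyIntegrable hLm (hball k y hy) ?_
    filter_upwards [ae_restrict_mem hLm] with t ht
    simpa [ht] using hb t ht
  · rw [hder k i y hy, abs_le]
    constructor
    · refine le_integral_mul_normed_sub (φ k) (hgi i).locallyIntegrable hLm (hball k y hy) ?_
      filter_upwards [ae_restrict_mem hLm, hB i] with t ht h2
      simpa [ht] using (abs_le.1 h2).1
    · refine integral_mul_normed_sub_le (φ k) (hgi i).locallyIntegrable hLm (hball k y hy) ?_
      filter_upwards [ae_restrict_mem hLm, hB i] with t ht h2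
      simpa [ht] using (abs_le.1 h2).2
  · have h1 := ae_restrict_of_ae (s := K) (hae hfi)
    have h2 := ae_restrict_of_ae (s := K) (ae_all_iff.2 fun i => hae (hgi i))
    filter_upwards [h1, h2, ae_restrict_mem hK.isClosed.measurableSet] with y hy1 hy2 hyK
    refine ⟨?_, fun i => ?_⟩
    · rw [indicator_of_mem (hKL hyK)] at hy1
      exact hy1
    · have := hy2 i
      rw [indicator_of_mem (hKL hyK)] at this
      simpa only [hder _ i y hyK] using this

end Mollification

/-! ### The metric, the volume density and gradients in chart coordinates. -/

section ChartGeometry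

open Filter Topology

/-- The inner product in terms of the inner products with a basis. -/
theorem inner_eq_sum_gram_inv {n : ℕ} {W : Type*} [NormedAddCommGroup W] [InnerProductSpace ℝ W]
    {b : Fin n → W} (hli : LinearIndependent ℝ b) (hsp : ⊤ ≤ Submodule.span ℝ (range b)) (x y : W) :
    inner ℝ x y = ∑ i, ∑ j, (Matrix.gram ℝ b)⁻¹ i j * inner ℝ x (b i) * inner ℝ y (b j) := by
  let B := Module.Basis.mk hli hsp
  have hB : ∀ i, B i = b i := fun i => by simp [B]
  set A := Matrix.gram ℝ b with hA
  have hAs : A.transpose = A := by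
    ext i j; simp [hA, Matrix.gram_apply, real_inner_comm]
  have hdet : IsUnit A.det :=
    isUnit_iff_ne_zero.2 (Matrix.posDef_gram_of_linearIndependent hli).det_pos.ne'
  let c : W → Fin n → ℝ := fun x i => B.repr x i
  have hx : ∀ x, x = ∑ i, c x i • b i := fun x => by
    conv_lhs => rw [← B.sum_repr x]
    simp [hB, c]
  have hin : ∀ x i, inner ℝ x (b i) = A.mulVec (c x) i := fun x i => by
    conv_lhs => rw [hx x]
    rw [sum_inner, Matrix.mulVec, dotProduct]
    refine Finset.sum_congr rfl fun k _ => ?_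
    rw [real_inner_smul_left, hA, Matrix.gram_apply, real_inner_comm, mul_comm]
  have h1 : inner ℝ x y = dotProduct (A.mulVec (c x)) (c y) := by
    conv_lhs => rw [hx y]
    rw [inner_sum, dotProduct]
    refine Finset.sum_congr rfl fun k _ => ?_
    rw [real_inner_smul_right, hin, mul_comm]
  -- Since `A c(y)` is the vector of inner products of `y` with the basis, this eliminates the
  -- coordinates of `y`.
  have h2 : c y = (A⁻¹).mulVec (A.mulVec (c y)) := by
    rw [Matrix.mulVec_mulVec, Matrix.nonsing_inv_mul _ hdet, Matrix.one_mulVec]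
  rw [h1, h2, dotProduct]
  refine Finset.sum_congr rfl fun i _ => ?_
  change _ * (∑ j, A⁻¹ i j * A.mulVec (c y) j) = _
  rw [Finset.mul_sum]
  refine Finset.sum_congr rfl fun j _ => ?_
  rw [hin, hin]
  ring

variable {n : ℕ} {M : Type*} [TopologicalSpace M] [ChartedSpace (EuclideanSpace ℝ (Fin n)) M]
  {e : OpenPartialHomeomorph M (EuclideanSpace ℝ (Fin n))}

/-- The coordinate field is the tangent map of `e.symm` applied to a constant field. Order 0
suffices, as only continuity of the Gram matrix is needed. -/
theorem contMDiffOn_coordVector [IsManifold (𝓡 n) ∞ M]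
    (he : e ∈ atlas (EuclideanSpace ℝ (Fin n)) M) (i : Fin n) :
    ContMDiffOn (𝓡 n) (𝓡 n).tangent 0
      (fun y => (⟨e.symm y, coordVector e y i⟩ : TangentBundle (𝓡 n) M)) e.target := by
  have : IsManifold (𝓡 n) 1 M := IsManifold.of_le (n := ∞) (by simp)
  have h1 : ContMDiffOn (𝓡 n) (𝓡 n) 1 e.symm e.target :=
    contMDiffOn_symm_of_mem_maximalAtlas (IsManifold.subset_maximalAtlas he)
  have h2 := h1.contMDiffOn_tangentMapWithin (m := 0) (by simp) e.open_target.uniqueMDiffOn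
  have h3 : ContMDiff (𝓡 n) (𝓡 n).tangent 0
      (fun y : EuclideanSpace ℝ (Fin n) =>
        (⟨y, (EuclideanSpace.single i 1 : EuclideanSpace ℝ (Fin n))⟩ :
          TangentBundle (𝓡 n) (EuclideanSpace ℝ (Fin n)))) :=
    contMDiff_vectorSpace_iff_contDiff.2 contDiff_const
  refine (h2.comp h3.contMDiffOn fun y hy => hy).congr fun y hy => ?_
  simp only [Function.comp, tangentMapWithin, coordVector, mfderivWithin_of_isOpen e.open_target hy]

theorem linearIndependent_coordVector [IsManifold (𝓡 n) ∞ M]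
    (he : e ∈ atlas (EuclideanSpace ℝ (Fin n)) M) {y : EuclideanSpace ℝ (Fin n)}
    (hy : y ∈ e.target) : LinearIndependent ℝ (coordVector e y) := by
  have : IsManifold (𝓡 n) 1 M := IsManifold.of_le (n := ∞) (by simp)
  let T := (mdifferentiable_of_mem_atlas (I := 𝓡 n) he).symm.mfderiv hy
  let T' : EuclideanSpace ℝ (Fin n) ≃ₗ[ℝ] TangentSpace (𝓡 n) (e.symm y) := T.toLinearEquiv
  have h := (EuclideanSpace.basisFun (Fin n) ℝ).toBasis.linearIndependent.map'
    (T' : EuclideanSpace ℝ (Fin n) →ₗ[ℝ] TangentSpace (𝓡 n) (e.symm y)) T'.ker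
  have hc : coordVector e y = T' ∘ (EuclideanSpace.basisFun (Fin n) ℝ).toBasis := by
    funext i
    simp only [Function.comp, OrthonormalBasis.coe_toBasis, EuclideanSpace.basisFun_apply]
    rfl
  rw [hc]
  exact h

theorem top_le_span_coordVector [IsManifold (𝓡 n) ∞ M]
    (he : e ∈ atlas (EuclideanSpace ℝ (Fin n)) M) {y : EuclideanSpace ℝ (Fin n)}
    (hy : y ∈ e.target) : ⊤ ≤ Submodule.span ℝ (range (coordVector e y)) := by
  refine ((linearIndependent_coordVector he hy).span_eq_top_of_card_eq_finrank' ?_).ge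
  have : Module.finrank ℝ (TangentSpace (𝓡 n) (e.symm y)) = Module.finrank ℝ (EuclideanSpace ℝ (Fin n)) := rfl
  rw [this]
  simp

variable [RiemannianBundle (fun x : M => TangentSpace (𝓡 n) x)]

theorem inner_gradient (f : M → ℝ) (x : M) (v : TangentSpace (𝓡 n) x) :
    inner ℝ (gradient f x) v = mfderiv (𝓡 n) 𝓘(ℝ, ℝ) f x v := by
  rw [gradient]
  exact InnerProductSpace.toDual_symm_apply
theorem inner_gradient_coordVector [IsManifold (𝓡 n) ∞ M]
    (he : e ∈ atlas (EuclideanSpace ℝ (Fin n)) M) {y : EuclideanSpace ℝ (Fin n)}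
    (hy : y ∈ e.target) {f : M → ℝ} (hf : MDifferentiableAt (𝓡 n) 𝓘(ℝ, ℝ) f (e.symm y)) (i : Fin n) :
    inner ℝ (gradient f (e.symm y)) (coordVector e y i) =
      fderiv ℝ (f ∘ e.symm) y (EuclideanSpace.single i 1) := by
  have : IsManifold (𝓡 n) 1 M := IsManifold.of_le (n := ∞) (by simp)
  rw [inner_gradient, ← mfderiv_eq_fderiv,
    mfderiv_comp y hf (mdifferentiableAt_atlas_symm (I := 𝓡 n) he hy)]
  rfl

/-- For `v = G` the right side involves `G` only through the pairings `⟨G, ∂ᵢ⟩`, the quantities that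
`HasWeakGradient` controls. -/
theorem inner_gradient_eq_sum [IsManifold (𝓡 n) ∞ M]
    (he : e ∈ atlas (EuclideanSpace ℝ (Fin n)) M) {y : EuclideanSpace ℝ (Fin n)}
    (hy : y ∈ e.target) {f : M → ℝ} (hf : MDifferentiableAt (𝓡 n) 𝓘(ℝ, ℝ) f (e.symm y))
    (v : TangentSpace (𝓡 n) (e.symm y)) :
    inner ℝ v (gradient f (e.symm y)) = ∑ i, ∑ j, (Matrix.gram ℝ (coordVector e y))⁻¹ i j *
      inner ℝ v (coordVector e y i) * fderiv ℝ (f ∘ e.symm) y (EuclideanSpace.single j 1) := by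
  rw [inner_eq_sum_gram_inv (linearIndependent_coordVector he hy) (top_le_span_coordVector he hy)]
  simp only [inner_gradient_coordVector he hy hf]

theorem continuousOn_gram_coordVector [IsManifold (𝓡 n) ∞ M]
    [IsContMDiffRiemannianBundle (𝓡 n) ∞ (EuclideanSpace ℝ (Fin n))
      (fun x : M => TangentSpace (𝓡 n) x)]
    (he : e ∈ atlas (EuclideanSpace ℝ (Fin n)) M) :
    ContinuousOn (fun y => Matrix.gram ℝ (coordVector e y)) e.target := by
  have : IsContMDiffRiemannianBundle (𝓡 n) 0 (EuclideanSpace ℝ (Fin n)) (fun x : M => TangentSpace (𝓡 n) x) :=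
    IsContMDiffRiemannianBundle.of_le (n := ∞) (by simp)
  refine continuousOn_pi.2 fun i => continuousOn_pi.2 fun j => ?_
  exact ((contMDiffOn_coordVector he i).inner_bundle (contMDiffOn_coordVector he j)).continuousOn

theorem posDef_gram_coordVector [IsManifold (𝓡 n) ∞ M]
    (he : e ∈ atlas (EuclideanSpace ℝ (Fin n)) M) {y : EuclideanSpace ℝ (Fin n)}
    (hy : y ∈ e.target) : (Matrix.gram ℝ (coordVector e y)).PosDef :=
  Matrix.posDef_gram_of_linearIndependent (linearIndependent_coordVector he hy)

theorem continuousOn_gram_inv_coordVector [IsManifold (𝓡 n) ∞ M]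
    [IsContMDiffRiemannianBundle (𝓡 n) ∞ (EuclideanSpace ℝ (Fin n))
      (fun x : M => TangentSpace (𝓡 n) x)]
    (he : e ∈ atlas (EuclideanSpace ℝ (Fin n)) M) (i j : Fin n) :
    ContinuousOn (fun y => (Matrix.gram ℝ (coordVector e y))⁻¹ i j) e.target := by
  have h := continuousOn_gram_coordVector he
  have hd : ContinuousOn (fun y => (Matrix.gram ℝ (coordVector e y)).det) e.target :=
    (continuous_id.matrix_det).comp_continuousOn h
  have ha : ContinuousOn (fun y => (Matrix.gram ℝ (coordVector e y)).adjugate i j) e.target :=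
    ((continuous_id.matrix_adjugate).matrix_elem i j).comp_continuousOn h
  refine ((hd.inv₀ fun y hy => (posDef_gram_coordVector he hy).det_pos.ne').mul ha).congr
    fun y hy => ?_
  simp [Matrix.inv_def, Ring.inverse_eq_inv']

theorem chartDensity_pos [IsManifold (𝓡 n) ∞ M]
    (he : e ∈ atlas (EuclideanSpace ℝ (Fin n)) M) {y : EuclideanSpace ℝ (Fin n)}
    (hy : y ∈ e.target) : 0 < chartDensity e y :=
  Real.sqrt_pos.2 (posDef_gram_coordVector he hy).det_pos

theorem continuousOn_chartDensity [IsManifold (𝓡 n) ∞ M]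
    [IsContMDiffRiemannianBundle (𝓡 n) ∞ (EuclideanSpace ℝ (Fin n))
      (fun x : M => TangentSpace (𝓡 n) x)]
    (he : e ∈ atlas (EuclideanSpace ℝ (Fin n)) M) : ContinuousOn (chartDensity e) e.target :=
  Real.continuous_sqrt.comp_continuousOn
    ((continuous_id.matrix_det).comp_continuousOn (continuousOn_gram_coordVector he))

/-- The scalar product of the gradients of two smooth functions is continuous. -/
theorem continuous_inner_gradient [IsManifold (𝓡 n) ∞ M]
    [IsContMDiffRiemannianBundle (𝓡 n) ∞ (EuclideanSpace ℝ (Fin n))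
      (fun x : M => TangentSpace (𝓡 n) x)]
    {f h : M → ℝ} (hf : ContMDiff (𝓡 n) 𝓘(ℝ, ℝ) ∞ f) (hh : ContMDiff (𝓡 n) 𝓘(ℝ, ℝ) ∞ h) :
    Continuous fun x => (inner ℝ (gradient (n := n) f x) (gradient (n := n) h x) : ℝ) := by
  rw [continuous_iff_continuousAt]
  intro x
  set e := chartAt (EuclideanSpace ℝ (Fin n)) x with hedef
  have he : e ∈ atlas (EuclideanSpace ℝ (Fin n)) M := chart_mem_atlas _ _
  have hx : x ∈ e.source := mem_chart_source _ _
  have hfd : ∀ {f : M → ℝ}, ContMDiff (𝓡 n) 𝓘(ℝ, ℝ) ∞ f → ∀ i : Fin n, ContinuousOn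
      (fun y => fderiv ℝ (f ∘ e.symm) y (EuclideanSpace.single i (1:ℝ))) e.target := by
    intro f hf i
    have h1 : ContMDiffOn (𝓡 n) 𝓘(ℝ, ℝ) ∞ (f ∘ e.symm) e.target := hf.comp_contMDiffOn
      (contMDiffOn_symm_of_mem_maximalAtlas (IsManifold.subset_maximalAtlas he))
    have h2 := (contMDiffOn_iff_contDiffOn.1 h1).continuousOn_fderiv_of_isOpen e.open_target (by simp)
    exact h2.clm_apply continuousOn_const
  have hc : ContinuousOn (fun y => (inner ℝ (gradient (n := n) f (e.symm y)) (gradient (n := n) h (e.symm y)) : ℝ))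
      e.target := by
    have : ContinuousOn (fun y => ∑ i, ∑ j, (Matrix.gram ℝ (coordVector e y))⁻¹ i j *
      fderiv ℝ (f ∘ e.symm) y (EuclideanSpace.single i (1:ℝ)) *
      fderiv ℝ (h ∘ e.symm) y (EuclideanSpace.single j (1:ℝ))) e.target :=
      continuousOn_finsetSum _ fun i _ => continuousOn_finsetSum _ fun j _ =>
        ((continuousOn_gram_inv_coordVector he i j).mul (hfd hf i)).mul (hfd hh j)
    refine this.congr fun y hy => ?_
    simp only [inner_gradient_eq_sum he hy (hh.mdifferentiable (by simp) _),
      inner_gradient_coordVector he hy (hf.mdifferentiable (by simp) _)]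
  have h3 : ContinuousOn (fun x => (inner ℝ (gradient (n := n) f x) (gradient (n := n) h x) : ℝ)) e.source := by
    refine (hc.comp e.continuousOn fun z hz => e.map_source hz).congr fun z hz => ?_
    simp only [Function.comp]
    rw [e.left_inv hz]
  exact h3.continuousAt (e.open_source.mem_nhds hx)

end ChartGeometry

/-! ### Passing between the Riemannian measure and Lebesgue measure in charts. -/

section MeasureTransfer

open Filter Topology

variable {n : ℕ} {M : Type*} [TopologicalSpace M] [SecondCountableTopology M]
  [ChartedSpace (EuclideanSpace ℝ (Fin n)) M]
  [RiemannianBundle (fun x : M => TangentSpace (𝓡 n) x)] [MeasurableSpace M]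

theorem aestronglyMeasurable_of_charts {f : M → ℝ}
    (h : ∀ e ∈ atlas (EuclideanSpace ℝ (Fin n)) M,
      AEStronglyMeasurable f ((riemannianVolume n M).restrict e.source)) :
    AEStronglyMeasurable f (riemannianVolume n M) := by
  obtain ⟨t, ht, htU⟩ := TopologicalSpace.countable_cover_nhds
    (f := fun x : M => (chartAt (EuclideanSpace ℝ (Fin n)) x).source)
    (fun x => chart_source_mem_nhds _ x)
  have : Countable t := ht.to_subtype
  rw [← Measure.restrict_univ (μ := riemannianVolume n M), ← htU, biUnion_eq_iUnion,
    aestronglyMeasurable_iUnion_iff]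
  exact fun x => h _ (chart_mem_atlas _ _)

variable [IsManifold (𝓡 n) ∞ M] [BorelSpace M]
  {e : OpenPartialHomeomorph M (EuclideanSpace ℝ (Fin n))}

theorem map_chartVolume (he : e ∈ atlas (EuclideanSpace ℝ (Fin n)) M) :
    AEMeasurable e (chartVolume e) ∧ (chartVolume e).map e =
      (volume.restrict e.target).withDensity (fun y => ENNReal.ofReal (chartDensity e y)) := by
  have hm : AEMeasurable e (chartVolume e) := by
    rw [← riemannianVolume_restrict he]
    exact e.continuousOn.aemeasurable e.open_source.measurableSet
  have hac := withDensity_absolutelyContinuous (volume.restrict e.target)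
    (fun y => ENNReal.ofReal (chartDensity e y))
  have hs : AEMeasurable e.symm ((volume.restrict e.target).withDensity
      (fun y => ENNReal.ofReal (chartDensity e y))) :=
    (e.continuousOn_symm.aemeasurable e.open_target.measurableSet).mono_ac hac
  refine ⟨hm, ?_⟩
  rw [chartVolume] at hm ⊢
  rw [AEMeasurable.map_map_of_aemeasurable hm hs]
  refine (Measure.map_congr (g := id) (hac.ae_le ?_)).trans Measure.map_id
  filter_upwards [ae_restrict_mem e.open_target.measurableSet] with y hy
  exact e.right_inv hy

theorem ae_restrict_source_of_ae (he : e ∈ atlas (EuclideanSpace ℝ (Fin n)) M) {P : M → Prop}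
    (h : ∀ᵐ y ∂volume.restrict e.target, P (e.symm y)) :
    ∀ᵐ x ∂(riemannianVolume n M).restrict e.source, P x := by
  obtain ⟨hm, hmap⟩ := map_chartVolume he
  have h1 : ∀ᵐ y ∂(chartVolume e).map e, P (e.symm y) := by
    rw [hmap]
    exact (withDensity_absolutelyContinuous _ _).ae_le h
  have h2 := ae_of_ae_map hm h1
  rw [← riemannianVolume_restrict he] at h2
  filter_upwards [h2, ae_restrict_mem e.open_source.measurableSet] with x hx hxe
  rwa [e.left_inv hxe] at hx

theorem aestronglyMeasurable_restrict_source (he : e ∈ atlas (EuclideanSpace ℝ (Fin n)) M)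
    {f : M → ℝ} (h : AEStronglyMeasurable (fun y => f (e.symm y)) (volume.restrict e.target)) :
    AEStronglyMeasurable f ((riemannianVolume n M).restrict e.source) := by
  obtain ⟨hm, hmap⟩ := map_chartVolume he
  have h1 : AEStronglyMeasurable (fun y => f (e.symm y)) ((chartVolume e).map e) := by
    rw [hmap]
    exact h.mono_ac (withDensity_absolutelyContinuous _ _)
  have h2 := h1.comp_aemeasurable hm
  rw [← riemannianVolume_restrict he] at h2
  refine h2.congr ?_
  filter_upwards [ae_restrict_mem e.open_source.measurableSet] with x hx
  simp [e.left_inv hx]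

variable [IsContMDiffRiemannianBundle (𝓡 n) ∞ (EuclideanSpace ℝ (Fin n))
  (fun x : M => TangentSpace (𝓡 n) x)]

/-- This direction relies on the positivity of the density: without it a `dv_g`-null set could have
positive Lebesgue measure in the chart. -/
theorem ae_restrict_target_of_ae (he : e ∈ atlas (EuclideanSpace ℝ (Fin n)) M) {P : M → Prop}
    (h : ∀ᵐ x ∂riemannianVolume n M, P x) : ∀ᵐ y ∂volume.restrict e.target, P (e.symm y) := by
  have h1 : ∀ᵐ x ∂chartVolume e, P x := by
    rw [← riemannianVolume_restrict he]
    exact ae_restrict_of_ae h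
  have hs : AEMeasurable e.symm (volume.restrict e.target) :=
    e.continuousOn_symm.aemeasurable e.open_target.measurableSet
  have h2 := ae_of_ae_map (hs.mono_ac (withDensity_absolutelyContinuous _ _)) h1
  have hd : AEMeasurable (fun y => ENNReal.ofReal (chartDensity e y)) (volume.restrict e.target) :=
    ((continuousOn_chartDensity he).aemeasurable e.open_target.measurableSet).ennreal_ofReal
  rw [ae_withDensity_iff' hd] at h2
  filter_upwards [h2, ae_restrict_mem e.open_target.measurableSet] with y hy hye
  exact hy (by simpa using chartDensity_pos he hye)

/-- The density is continuous, hence integrable on a small closed coordinate ball. Compact sets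
therefore have finite volume, which all later domination arguments use. -/
instance isLocallyFiniteMeasure_riemannianVolume : IsLocallyFiniteMeasure (riemannianVolume n M) := by
  refine ⟨fun x => ?_⟩
  set e := chartAt (EuclideanSpace ℝ (Fin n)) x with hedef
  have he : e ∈ atlas (EuclideanSpace ℝ (Fin n)) M := chart_mem_atlas _ _
  have hx : x ∈ e.source := mem_chart_source _ _
  obtain ⟨ε, hε, hball⟩ := Metric.nhds_basis_closedBall.mem_iff.1
    (e.open_target.mem_nhds (e.map_source hx))
  refine ⟨e.source ∩ e ⁻¹' Metric.ball (e x) ε, ?_, ?_⟩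
  · exact inter_mem (e.open_source.mem_nhds hx)
      ((e.continuousAt hx).preimage_mem_nhds (Metric.ball_mem_nhds _ hε))
  · have hm : MeasurableSet (e.source ∩ e ⁻¹' Metric.ball (e x) ε) :=
      (e.continuousOn.isOpen_inter_preimage e.open_source Metric.isOpen_ball).measurableSet
    have h1 : riemannianVolume n M (e.source ∩ e ⁻¹' Metric.ball (e x) ε) =
        chartVolume e (e.source ∩ e ⁻¹' Metric.ball (e x) ε) := by
      rw [← riemannianVolume_restrict he, Measure.restrict_eq_self _ inter_subset_left]
    rw [h1, chartVolume_apply e hm]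
    have hint : IntegrableOn (chartDensity e) (Metric.closedBall (e x) ε) :=
      ((continuousOn_chartDensity he).mono hball).integrableOn_compact (isCompact_closedBall _ _)
    refine lt_of_le_of_lt (lintegral_mono_set ?_) hint.setLIntegral_lt_top
    rintro y ⟨hy, -, hy2⟩
    simp only [mem_preimage, e.right_inv hy] at hy2
    exact Metric.ball_subset_closedBall hy2

/-- No measurability of `G` as a section is assumed; it is recovered from the local integrability of
its chart components. -/
theorem aestronglyMeasurable_inner_gradient {ρ : M → ℝ} {G : (x : M) → TangentSpace (𝓡 n) x}
    (hG : HasWeakGradient ρ G) {f : M → ℝ} (hf : ContMDiff (𝓡 n) 𝓘(ℝ, ℝ) ∞ f) :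
    AEStronglyMeasurable (fun x => (inner ℝ (G x) (gradient f x) : ℝ)) (riemannianVolume n M) := by
  refine aestronglyMeasurable_of_charts fun e he => aestronglyMeasurable_restrict_source he ?_
  have hm := e.open_target.measurableSet
  have h1 : ContMDiffOn (𝓡 n) 𝓘(ℝ, ℝ) ∞ (f ∘ e.symm) e.target := hf.comp_contMDiffOn
    (contMDiffOn_symm_of_mem_maximalAtlas (IsManifold.subset_maximalAtlas he))
  have h2 := (contMDiffOn_iff_contDiffOn.1 h1).continuousOn_fderiv_of_isOpen e.open_target (by simp)
  have h3 : AEStronglyMeasurable (fun y => ∑ i, ∑ j, (Matrix.gram ℝ (coordVector e y))⁻¹ i j *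
      (inner ℝ (G (e.symm y)) (coordVector e y i) : ℝ) *
      fderiv ℝ (f ∘ e.symm) y (EuclideanSpace.single j 1)) (volume.restrict e.target) := by
    refine Finset.aestronglyMeasurable_fun_sum _ fun i _ =>
      Finset.aestronglyMeasurable_fun_sum _ fun j _ => ?_
    refine (((continuousOn_gram_inv_coordVector he i j).aestronglyMeasurable hm).mul
      ((hG.locallyIntegrableOn_grad e he i).aestronglyMeasurable)).mul ?_
    exact (h2.clm_apply continuousOn_const).aestronglyMeasurable hm
  refine h3.congr ?_
  filter_upwards [ae_restrict_mem hm] with y hy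
  exact (inner_gradient_eq_sum he hy (hf.mdifferentiable (by simp) _) _).symm

theorem integrable_of_bounded_on_compact [T2Space M] {K : Set M} (hK : IsCompact K) {F : M → ℝ}
    (hF : AEStronglyMeasurable F (riemannianVolume n M)) (h0 : ∀ x ∉ K, F x = 0) {B : ℝ}
    (hB : ∀ᵐ x ∂riemannianVolume n M, x ∈ K → |F x| ≤ B) : Integrable F (riemannianVolume n M) := by
  have h : IntegrableOn F K (riemannianVolume n M) := by
    refine Measure.integrableOn_of_bounded (M := B) hK.measure_lt_top.ne hF ?_
    exact (ae_restrict_iff' hK.measurableSet).2 hB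
  rw [← integrable_indicator_iff hK.measurableSet] at h
  rwa [indicator_eq_self.2 fun x hx => by_contra fun hxK => hx (h0 x hxK)] at h

/-- Approximation, near a compact set in the domain of a chart, of a positive continuous
function `ρ` with weak gradient `G` by smooth functions. -/
theorem exists_approx_in_chart {ρ : M → ℝ} (hρ : Continuous ρ)
    {G : (x : M) → TangentSpace (𝓡 n) x} (hG : HasWeakGradient ρ G) {N : M → ℝ} (hN : Continuous N)
    (hGN : ∀ᵐ x ∂riemannianVolume n M, ‖G x‖ ≤ N x) (he : e ∈ atlas (EuclideanSpace ℝ (Fin n)) M)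
    {K : Set M} (hK : IsCompact K) (hKe : K ⊆ e.source) (hpos : ∀ x ∈ K, 0 < ρ x) :
    ∃ (r : ℕ → M → ℝ) (a b B : ℝ), 0 < a ∧
      (∀ k, ContMDiffOn (𝓡 n) 𝓘(ℝ, ℝ) ∞ (r k) e.source) ∧
      (∀ k, ∀ x ∈ K, a ≤ r k x ∧ r k x ≤ b) ∧
      ∀ᵐ x ∂riemannianVolume n M, x ∈ K → Tendsto (fun k => r k x) atTop (𝓝 (ρ x)) ∧
        Tendsto (fun k => (inner ℝ (G x) (gradient (r k) x) : ℝ)) atTop (𝓝 (inner ℝ (G x) (G x))) ∧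
        ∀ k, |(inner ℝ (G x) (gradient (r k) x) : ℝ)| ≤ B := by
  set K' := e '' K with hK'
  have hK'c : IsCompact K' := hK.image_of_continuousOn (e.continuousOn.mono hKe)
  have hK't : K' ⊆ e.target := by
    rintro _ ⟨x, hx, rfl⟩
    exact e.map_source (hKe hx)
  have hsymm : ∀ y ∈ K', e.symm y ∈ K := by
    rintro _ ⟨x, hx, rfl⟩
    rwa [e.left_inv (hKe hx)]
  -- Cauchy–Schwarz: `|⟨G, ∂ᵢ⟩| ≤ N √gᵢᵢ`, which is continuous on the chart.
  have hGb : ∀ L, IsCompact L → L ⊆ e.target → ∃ B, ∀ i, ∀ᵐ y ∂volume.restrict L,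
      |(inner ℝ (G (e.symm y)) (coordVector e y i) : ℝ)| ≤ B := by
    intro L hL hLt
    have hc : ∀ i : Fin n, ContinuousOn (fun y => N (e.symm y) *
        Real.sqrt (Matrix.gram ℝ (coordVector e y) i i)) L := fun i =>
      (hN.comp_continuousOn (e.continuousOn_symm.mono hLt)).mul
        (Real.continuous_sqrt.comp_continuousOn
          (((continuous_id.matrix_elem i i).comp_continuousOn
            (continuousOn_gram_coordVector he)).mono hLt))
    have hb : ∀ i, ∃ b, ∀ y ∈ L, N (e.symm y) *
        Real.sqrt (Matrix.gram ℝ (coordVector e y) i i) ≤ b := fun i => by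
      obtain ⟨b, hb⟩ := hL.bddAbove_image (hc i)
      exact ⟨b, fun y hy => hb ⟨y, hy, rfl⟩⟩
    choose b hb using hb
    refine ⟨∑ i, |b i|, fun i => ?_⟩
    have h1 := ae_restrict_of_ae_restrict_of_subset hLt (ae_restrict_target_of_ae he hGN)
    filter_upwards [h1, ae_restrict_mem hL.isClosed.measurableSet] with y hy hyL
    calc |(inner ℝ (G (e.symm y)) (coordVector e y i) : ℝ)|
        ≤ ‖G (e.symm y)‖ * ‖coordVector e y i‖ := abs_real_inner_le_norm _ _
      _ ≤ N (e.symm y) * ‖coordVector e y i‖ := by gcongr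
      _ = N (e.symm y) * Real.sqrt (Matrix.gram ℝ (coordVector e y) i i) := by
          rw [Matrix.gram_apply, real_inner_self_eq_norm_sq, Real.sqrt_sq (norm_nonneg _)]
      _ ≤ |b i| := (hb i y hyL).trans (le_abs_self _)
      _ ≤ ∑ i, |b i| := Finset.single_le_sum (f := fun i => |b i|) (fun _ _ => abs_nonneg _)
          (Finset.mem_univ i)
  obtain ⟨r, a, b, B, ha, hr, hab, hB, hlim⟩ := exists_smooth_approx e.open_target hK'c hK't
    (f := fun y => ρ (e.symm y)) (hρ.comp_continuousOn e.continuousOn_symm)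
    (fun y hy => hpos _ (hsymm y hy))
    (g := fun i y => inner ℝ (G (e.symm y)) (coordVector e y i))
    (hG.locallyIntegrableOn_grad e he) hGb (hG.integral_eq e he)
  obtain ⟨B₁, hB₁⟩ := hGb K' hK'c hK't
  have hgi : ∃ B₂ : ℝ, ∀ i j, ∀ y ∈ K', |(Matrix.gram ℝ (coordVector e y))⁻¹ i j| ≤ B₂ := by
    have hb : ∀ i j, ∃ b, ∀ y ∈ K', |(Matrix.gram ℝ (coordVector e y))⁻¹ i j| ≤ b := fun i j => by
      obtain ⟨b, hb⟩ := hK'c.bddAbove_image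
        ((continuousOn_gram_inv_coordVector he i j).mono hK't).abs
      exact ⟨b, fun y hy => hb ⟨y, hy, rfl⟩⟩
    choose b hb using hb
    refine ⟨∑ i, ∑ j, |b i j|, fun i j y hy => ((hb i j y hy).trans (le_abs_self _)).trans ?_⟩
    exact (Finset.single_le_sum (f := fun j => |b i j|) (fun _ _ => abs_nonneg _)
      (Finset.mem_univ j)).trans (Finset.single_le_sum (f := fun i => ∑ j, |b i j|)
        (fun _ _ => Finset.sum_nonneg fun _ _ => abs_nonneg _) (Finset.mem_univ i))
  obtain ⟨B₂, hB₂⟩ := hgi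
  have hsm : ∀ k, ContMDiffOn (𝓡 n) 𝓘(ℝ, ℝ) ∞ (r k ∘ e) e.source := fun k =>
    (contMDiff_iff_contDiff.2 (hr k)).comp_contMDiffOn
      (contMDiffOn_of_mem_maximalAtlas (IsManifold.subset_maximalAtlas he))
  refine ⟨fun k => r k ∘ e, a, b, ∑ _i : Fin n, ∑ _j : Fin n, B₂ * B₁ * B, ha, hsm,
    fun k x hx => hab k (e x) ⟨x, hx, rfl⟩, ?_⟩
  have hder : ∀ k, ∀ y ∈ e.target, fderiv ℝ ((r k ∘ e) ∘ e.symm) y = fderiv ℝ (r k) y := by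
    intro k y hy
    refine Filter.EventuallyEq.fderiv_eq ?_
    filter_upwards [e.open_target.mem_nhds hy] with z hz
    simp [e.right_inv hz]
  have key : ∀ᵐ x ∂(riemannianVolume n M).restrict e.source, x ∈ K →
      Tendsto (fun k => (r k ∘ e) x) atTop (𝓝 (ρ x)) ∧
        Tendsto (fun k => (inner ℝ (G x) (gradient (r k ∘ e) x) : ℝ)) atTop
          (𝓝 (inner ℝ (G x) (G x))) ∧
        ∀ k, |(inner ℝ (G x) (gradient (r k ∘ e) x) : ℝ)| ≤ ∑ _i : Fin n, ∑ _j : Fin n, B₂ * B₁ * B := by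
    refine ae_restrict_source_of_ae he ?_
    have hB₁' := ae_all_iff.2 hB₁
    rw [ae_restrict_iff' hK'c.isClosed.measurableSet] at hlim hB₁'
    filter_upwards [ae_restrict_of_ae hlim, ae_restrict_of_ae hB₁',
      ae_restrict_mem e.open_target.measurableSet] with y hy hy1 hyt hyK
    have hyK' : y ∈ K' := ⟨_, hyK, e.right_inv hyt⟩
    obtain ⟨hl1, hl2⟩ := hy hyK'
    -- Only the factors `∂ⱼ r k` depend on `k`. They are uniformly bounded and tend to `⟨G, ∂ⱼ⟩`, so
    -- this formula gives both the bound and the limit `⟨G, G⟩`.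
    have hform : ∀ k, (inner ℝ (G (e.symm y)) (gradient (r k ∘ e) (e.symm y)) : ℝ) =
        ∑ i, ∑ j, (Matrix.gram ℝ (coordVector e y))⁻¹ i j *
          inner ℝ (G (e.symm y)) (coordVector e y i) *
          fderiv ℝ (r k) y (EuclideanSpace.single j 1) := by
      intro k
      have hd : MDifferentiableAt (𝓡 n) 𝓘(ℝ, ℝ) (r k ∘ e) (e.symm y) :=
        ((hsm k).contMDiffAt (e.open_source.mem_nhds (e.map_target hyt))).mdifferentiableAt (by simp)
      rw [inner_gradient_eq_sum he hyt hd, hder k y hyt]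
    refine ⟨?_, ?_, fun k => ?_⟩
    · simpa [e.right_inv hyt] using hl1
    · simp only [hform]
      rw [inner_eq_sum_gram_inv (linearIndependent_coordVector he hyt)
        (top_le_span_coordVector he hyt)]
      exact tendsto_finsetSum _ fun i _ => tendsto_finsetSum _ fun j _ => (hl2 j).const_mul _
    · rw [hform]
      refine (Finset.abs_sum_le_sum_abs _ _).trans (Finset.sum_le_sum fun i _ => ?_)
      refine (Finset.abs_sum_le_sum_abs _ _).trans (Finset.sum_le_sum fun j _ => ?_)
      rw [abs_mul, abs_mul]
      have h0 := hB₂ i j y hyK'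
      have h1 := hy1 hyK' i
      gcongr
      · exact mul_nonneg ((abs_nonneg _).trans h0) ((abs_nonneg _).trans h1)
      · exact (abs_nonneg _).trans h0
      · exact hB k j y hyK'
  rw [ae_restrict_iff' e.open_source.measurableSet] at key
  filter_upwards [key] with x hx hxK using hx (hKe hxK) hxK

end MeasureTransfer

/-! ### Algebra of test functions and calculus rules for gradients. -/

section GradientCalculus

open Filter Topology

variable {n : ℕ} {M : Type*} [TopologicalSpace M] [ChartedSpace (EuclideanSpace ℝ (Fin n)) M]

theorem IsTestFunction.add {ρ f g : M → ℝ} (hf : IsTestFunction n ρ f) (hg : IsTestFunction n ρ g) :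
    IsTestFunction n ρ fun x => f x + g x :=
  ⟨hf.smooth.add hg.smooth, hf.compact.add hg.compact,
    (tsupport_add f g).trans (union_subset hf.support hg.support)⟩

/-- Smoothness of `f` is asked only on the support of `g`, because the powers `r ^ β` of local
approximations of `ρ` are controlled only there. -/
theorem IsTestFunction.of_mul {ρ f g : M → ℝ} (hg : IsTestFunction n ρ g)
    (hf : ∀ x ∈ tsupport g, ContMDiffAt (𝓡 n) 𝓘(ℝ, ℝ) ∞ f x) :
    IsTestFunction n ρ fun x => f x * g x := by
  have hsub : tsupport (fun x => f x * g x) ⊆ tsupport g := tsupport_mul_subset_right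
  exact ⟨contMDiff_of_tsupport fun x hx => (hf x (hsub hx)).mul hg.smooth.contMDiffAt,
    hg.compact.mul_left, hsub.trans hg.support⟩

theorem IsTestFunction.comp_left {ρ f : M → ℝ} (hf : IsTestFunction n ρ f) {h : ℝ → ℝ}
    (hh : ContDiff ℝ ∞ h) (h0 : h 0 = 0) : IsTestFunction n ρ fun x => h (f x) := by
  have hsub : tsupport (fun x => h (f x)) ⊆ tsupport f :=
    closure_mono fun x hx hfx => hx (by simp only [hfx, h0])
  exact ⟨hh.contMDiff.comp hf.smooth, hf.compact.comp_left h0, hsub.trans hf.support⟩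

theorem contMDiff_exp_rpow {u : M → ℝ} (hu : ContMDiff (𝓡 n) 𝓘(ℝ, ℝ) ∞ u) (a : ℝ) :
    ContMDiff (𝓡 n) 𝓘(ℝ, ℝ) ∞ fun x => Real.exp (u x) ^ a := by
  simp_rw [← Real.exp_mul]
  exact (Real.contDiff_exp.comp (contDiff_id.mul contDiff_const)).contMDiff.comp hu

theorem IsTestFunction.exp_rpow_mul {u ρ : M → ℝ} (hu : ContMDiff (𝓡 n) 𝓘(ℝ, ℝ) ∞ u) (a : ℝ)
    {ζ : M → ℝ} (hζ : IsTestFunction n ρ ζ) :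
    IsTestFunction n ρ fun x => Real.exp (u x) ^ a * ζ x :=
  hζ.of_mul fun _ _ => (contMDiff_exp_rpow hu a).contMDiffAt

variable [RiemannianBundle (fun x : M => TangentSpace (𝓡 n) x)]

theorem inner_gradient_right (f : M → ℝ) (x : M) (v : TangentSpace (𝓡 n) x) :
    inner ℝ v (gradient f x) = mfderiv (𝓡 n) 𝓘(ℝ, ℝ) f x v := by
  rw [real_inner_comm, inner_gradient]

theorem inner_gradient_comp {f : M → ℝ} {x : M} {h : ℝ → ℝ} {h' : ℝ}
    (hf : MDifferentiableAt (𝓡 n) 𝓘(ℝ, ℝ) f x) (hh : HasDerivAt h h' (f x))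
    (v : TangentSpace (𝓡 n) x) :
    (inner ℝ v (gradient (fun y => h (f y)) x) : ℝ) = h' * inner ℝ v (gradient f x) := by
  rw [inner_gradient_right, inner_gradient_right]
  have h1 := (hh.hasFDerivAt.hasMFDerivAt).comp x hf.hasMFDerivAt
  have h2 : mfderiv (𝓡 n) 𝓘(ℝ, ℝ) (fun y => h (f y)) x = _ := h1.mfderiv
  rw [h2]
  exact mul_comm _ _

theorem inner_gradient_mul {f g : M → ℝ} {x : M} (hf : MDifferentiableAt (𝓡 n) 𝓘(ℝ, ℝ) f x)
    (hg : MDifferentiableAt (𝓡 n) 𝓘(ℝ, ℝ) g x) (v : TangentSpace (𝓡 n) x) :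
    (inner ℝ v (gradient (fun y => f y * g y) x) : ℝ) =
      f x * inner ℝ v (gradient g x) + g x * inner ℝ v (gradient f x) := by
  rw [inner_gradient_right, inner_gradient_right, inner_gradient_right]
  have h1 := hf.hasMFDerivAt.mul hg.hasMFDerivAt
  have h2 : mfderiv (𝓡 n) 𝓘(ℝ, ℝ) (fun y => f y * g y) x = _ := h1.mfderiv
  rw [h2]
  rfl

theorem inner_gradient_add {f g : M → ℝ} {x : M} (hf : MDifferentiableAt (𝓡 n) 𝓘(ℝ, ℝ) f x)
    (hg : MDifferentiableAt (𝓡 n) 𝓘(ℝ, ℝ) g x) (v : TangentSpace (𝓡 n) x) :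
    (inner ℝ v (gradient (fun y => f y + g y) x) : ℝ) =
      inner ℝ v (gradient f x) + inner ℝ v (gradient g x) := by
  rw [inner_gradient_right, inner_gradient_right, inner_gradient_right]
  have h1 := hf.hasMFDerivAt.add hg.hasMFDerivAt
  have h2 : mfderiv (𝓡 n) 𝓘(ℝ, ℝ) (fun y => f y + g y) x = _ := h1.mfderiv
  rw [h2]
  rfl

theorem gradient_eq_zero_of_notMem_tsupport {f : M → ℝ} {x : M} (hx : x ∉ tsupport f) :
    gradient (n := n) f x = 0 := by
  have h : f =ᶠ[𝓝 x] fun _ => 0 := notMem_tsupport_iff_eventuallyEq.1 hx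
  rw [gradient, h.mfderiv_eq, mfderiv_const]
  exact map_zero _

theorem inner_gradient_exp_rpow {u : M → ℝ} {x : M} (hu : MDifferentiableAt (𝓡 n) 𝓘(ℝ, ℝ) u x)
    (a : ℝ) (v : TangentSpace (𝓡 n) x) :
    (inner ℝ v (gradient (fun y => Real.exp (u y) ^ a) x) : ℝ) =
      a * Real.exp (u x) ^ a * inner ℝ v (gradient u x) := by
  simp_rw [← Real.exp_mul]
  have h : HasDerivAt (fun t : ℝ => Real.exp (t * a)) (Real.exp (u x * a) * (1 * a)) (u x) :=
    ((hasDerivAt_id _).mul_const a).exp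
  rw [inner_gradient_comp hu h]
  ring

theorem norm_eq_of_norm_affineGradient {u : M → ℝ} {G : (x : M) → TangentSpace (𝓡 n) x}
    {lam mu : ℝ} {x : M} (h : ‖affineGradient u lam mu G x‖ = 1) :
    ‖G x‖ = Real.exp (u x) ^ (lam - mu) := by
  have hpos := Real.rpow_pos_of_pos (Real.exp_pos (u x)) (mu - lam)
  rw [affineGradient, norm_smul, Real.norm_of_nonneg hpos.le] at h
  rw [← neg_sub mu lam, Real.rpow_neg (Real.exp_pos _).le]
  exact eq_inv_of_mul_eq_one_right h

end GradientCalculus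

/-! ### Integrability on compact supports and the divergence form of the affine Laplacian. -/

section Integrability

open Filter Topology

variable {n : ℕ} {M : Type*} [TopologicalSpace M]
  [ChartedSpace (EuclideanSpace ℝ (Fin n)) M] [IsManifold (𝓡 n) ∞ M]
  [RiemannianBundle (fun x : M => TangentSpace (𝓡 n) x)]
  [IsContMDiffRiemannianBundle (𝓡 n) ∞ (EuclideanSpace ℝ (Fin n))
    (fun x : M => TangentSpace (𝓡 n) x)]
  [MeasurableSpace M]

theorem exists_abs_le_of_continuousOn {X : Type*} [TopologicalSpace X] {K : Set X}
    (hK : IsCompact K) {A : X → ℝ}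
    (hA : ContinuousOn A K) : ∃ B, 0 ≤ B ∧ ∀ x ∈ K, |A x| ≤ B := by
  obtain ⟨B, hB⟩ := hK.bddAbove_image hA.abs
  exact ⟨max B 0, le_max_right _ _, fun x hx => (hB ⟨x, hx, rfl⟩).trans (le_max_left _ _)⟩

theorem abs_inner_gradient_le_on_compact {G : (x : M) → TangentSpace (𝓡 n) x} {N : M → ℝ}
    (hN : Continuous N) (hGN : ∀ᵐ x ∂riemannianVolume n M, ‖G x‖ ≤ N x) {f : M → ℝ}
    (hf : ContMDiff (𝓡 n) 𝓘(ℝ, ℝ) ∞ f) {K : Set M} (hK : IsCompact K) :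
    ∃ B, 0 ≤ B ∧ ∀ᵐ x ∂riemannianVolume n M, x ∈ K → |(inner ℝ (G x) (gradient f x) : ℝ)| ≤ B := by
  obtain ⟨B, hB0, hB⟩ := exists_abs_le_of_continuousOn hK (A := fun x => N x *
    Real.sqrt (inner ℝ (gradient (n := n) f x) (gradient (n := n) f x)))
    (hN.mul (continuous_inner_gradient hf hf).sqrt).continuousOn
  refine ⟨B, hB0, ?_⟩
  filter_upwards [hGN] with x hx hxK
  refine (abs_real_inner_le_norm _ _).trans (le_trans ?_ ((le_abs_self _).trans (hB x hxK)))
  rw [real_inner_self_eq_norm_sq, Real.sqrt_sq (norm_nonneg _)]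
  gcongr

variable [T2Space M] [SecondCountableTopology M] [BorelSpace M]

theorem tendsto_integral_of_bounded_on_compact {K : Set M} (hK : IsCompact K) {F : ℕ → M → ℝ}
    {F' : M → ℝ} (hF : ∀ k, AEStronglyMeasurable (F k) (riemannianVolume n M))
    (h0 : ∀ k, ∀ x ∉ K, F k x = 0) (h0' : ∀ x ∉ K, F' x = 0) {B : ℝ}
    (hB : ∀ᵐ x ∂riemannianVolume n M, x ∈ K → ∀ k, |F k x| ≤ B)
    (hlim : ∀ᵐ x ∂riemannianVolume n M, x ∈ K → Tendsto (fun k => F k x) atTop (𝓝 (F' x))) :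
    Tendsto (fun k => ∫ x, F k x ∂riemannianVolume n M) atTop
      (𝓝 (∫ x, F' x ∂riemannianVolume n M)) := by
  refine tendsto_integral_of_dominated_convergence (K.indicator fun _ => B) hF
    ((integrable_indicator_iff hK.measurableSet).2 (integrableOn_const hK.measure_lt_top.ne))
    (fun k => ?_) ?_
  · filter_upwards [hB] with x hx
    by_cases hxK : x ∈ K
    · simpa [hxK] using hx hxK k
    · simp [hxK, h0 k x hxK]
  · filter_upwards [hlim] with x hx
    by_cases hxK : x ∈ K
    · exact hx hxK
    · simp only [h0 _ x hxK, h0' x hxK]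
      exact tendsto_const_nhds

theorem integrable_mul_of_tsupport {A ζ : M → ℝ} (hA : Measurable A)
    (hAK : ContinuousOn A (tsupport ζ)) (hζ : Continuous ζ) (hζc : HasCompactSupport ζ) :
    Integrable (fun x => A x * ζ x) (riemannianVolume n M) := by
  obtain ⟨B, -, hB⟩ := exists_abs_le_of_continuousOn hζc (hAK.mul hζ.continuousOn)
  refine integrable_of_bounded_on_compact hζc (hA.mul hζ.measurable).aestronglyMeasurable
    (fun x hx => by simp [image_eq_zero_of_notMem_tsupport hx]) (ae_of_all _ hB)

theorem integrable_mul_inner_gradient {ρ : M → ℝ} {G : (x : M) → TangentSpace (𝓡 n) x}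
    (hG : HasWeakGradient ρ G) {N : M → ℝ}
    (hN : Continuous N) (hGN : ∀ᵐ x ∂riemannianVolume n M, ‖G x‖ ≤ N x) {f : M → ℝ}
    (hf : ContMDiff (𝓡 n) 𝓘(ℝ, ℝ) ∞ f) {A : M → ℝ} (hA : Measurable A) {K : Set M}
    (hK : IsCompact K) (hAK : ContinuousOn A K)
    (h0 : ∀ x ∉ K, A x * inner ℝ (G x) (gradient f x) = 0) :
    Integrable (fun x => A x * inner ℝ (G x) (gradient f x)) (riemannianVolume n M) := by
  obtain ⟨B, hB0, hB⟩ := abs_inner_gradient_le_on_compact hN hGN hf hK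
  obtain ⟨B', hB'0, hB'⟩ := exists_abs_le_of_continuousOn hK hAK
  refine integrable_of_bounded_on_compact hK
    (hA.aestronglyMeasurable.mul (aestronglyMeasurable_inner_gradient hG hf)) h0 (B := B' * B) ?_
  filter_upwards [hB] with x hx hxK
  rw [abs_mul]
  exact mul_le_mul (hB' x hxK) (hx hxK) (abs_nonneg _) hB'0

/-- The affine Laplacian tested against `V ^ τ η`: the weight `V ^ τ` makes it self-adjoint. -/
theorem affineLaplacian_exp_rpow_mul {u : M → ℝ} (hu : ContMDiff (𝓡 n) 𝓘(ℝ, ℝ) ∞ u)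
    {lam mu tau : ℝ} (htau : tau = (n + 1) * lam + mu) {ρ : M → ℝ}
    {G : (x : M) → TangentSpace (𝓡 n) x} (hG : HasWeakGradient ρ G) {N : M → ℝ}
    (hN : Continuous N) (hGN : ∀ᵐ x ∂riemannianVolume n M, ‖G x‖ ≤ N x) {η : M → ℝ}
    (hη : IsTestFunction n ρ η) :
    affineLaplacian u lam mu G (fun x => Real.exp (u x) ^ tau * η x) =
      -∫ x, Real.exp (u x) ^ (tau + mu - lam) * inner ℝ (G x) (gradient η x)
        ∂riemannianVolume n M := by
  set s := tau + mu - lam with hs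
  have hw : ∀ x, Real.exp (u x) ^ (mu - lam) * (Real.exp (u x) ^ tau * η x) =
      Real.exp (u x) ^ s * η x := fun x => by
    rw [← mul_assoc, ← Real.rpow_add (Real.exp_pos _)]
    congr 2
    rw [hs]; ring
  -- This is the reason for the value of `τ`: the drift coefficient equals the exponent of the total
  -- weight, so the drift cancels the derivative of that weight.
  have hs2 : 2 * mu + n * lam = s := by rw [hs, htau]; ring
  have hwc := contMDiff_exp_rpow hu s
  have hgr : ∀ x, (inner ℝ (G x) (gradient (fun y => Real.exp (u y) ^ s * η y) x) : ℝ) =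
      Real.exp (u x) ^ s * inner ℝ (G x) (gradient η x) +
        s * Real.exp (u x) ^ s * η x * inner ℝ (G x) (gradient u x) := fun x => by
    rw [inner_gradient_mul (hwc.mdifferentiable (by simp) x)
      (hη.smooth.mdifferentiable (by simp) x), inner_gradient_exp_rpow
      (hu.mdifferentiable (by simp) x)]
    ring
  have hi1 : Integrable (fun x => Real.exp (u x) ^ s * inner ℝ (G x) (gradient η x))
      (riemannianVolume n M) :=
    integrable_mul_inner_gradient hG hN hGN hη.smooth hwc.continuous.measurable hη.compact
      hwc.continuous.continuousOn fun x hx => by simp [gradient_eq_zero_of_notMem_tsupport hx]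
  have hc2 : Continuous fun x => s * Real.exp (u x) ^ s * η x :=
    (continuous_const.mul hwc.continuous).mul hη.smooth.continuous
  have hi2 : Integrable (fun x => s * Real.exp (u x) ^ s * η x * inner ℝ (G x) (gradient u x))
      (riemannianVolume n M) :=
    integrable_mul_inner_gradient hG hN hGN hu hc2.measurable hη.compact hc2.continuousOn
      fun x hx => by simp [image_eq_zero_of_notMem_tsupport hx]
  rw [affineLaplacian, distLaplacian]
  simp only [hw, hgr, hs2]
  rw [integral_add hi1 hi2]
  have : ∀ x, s * inner ℝ (gradient u x) (G x) * (Real.exp (u x) ^ s * η x) =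
      s * Real.exp (u x) ^ s * η x * inner ℝ (G x) (gradient u x) := fun x => by
    rw [real_inner_comm]; ring
  simp only [this]
  ring

end Integrability

/-! ### Measurability and continuity of the weights `ρ^β V^a` away from the zeros of `ρ`. -/

section Weights

variable {n : ℕ} {M : Type*} [TopologicalSpace M]
  [ChartedSpace (EuclideanSpace ℝ (Fin n)) M] {u ρ : M → ℝ}

theorem measurable_rpow_mul_exp_rpow [MeasurableSpace M] [BorelSpace M]
    (hu : ContMDiff (𝓡 n) 𝓘(ℝ, ℝ) ∞ u) (hρ : Continuous ρ) (β a : ℝ) :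
    Measurable fun x => ρ x ^ β * Real.exp (u x) ^ a :=
  (hρ.measurable.pow_const β).mul (contMDiff_exp_rpow hu a).continuous.measurable

theorem continuousOn_rpow_mul_exp_rpow (hu : ContMDiff (𝓡 n) 𝓘(ℝ, ℝ) ∞ u) (hρ : Continuous ρ)
    (β a : ℝ) {K : Set M} (hK : K ⊆ {x | ρ x ≠ 0}) :
    ContinuousOn (fun x => ρ x ^ β * Real.exp (u x) ^ a) K :=
  (hρ.continuousOn.rpow_const fun _ hx => Or.inl (hK hx)).mul
    (contMDiff_exp_rpow hu a).continuous.continuousOn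

end Weights

/-! ### The first-order integral form and the substitution of `ρ^β ζ` for `ζ`. -/

section HardyForm

open Filter Topology

variable {n : ℕ} {M : Type*} [TopologicalSpace M]
  [ChartedSpace (EuclideanSpace ℝ (Fin n)) M]
  [RiemannianBundle (fun x : M => TangentSpace (𝓡 n) x)] [MeasurableSpace M]

/-- `∫ (c ρ^(β-1) e^(au) ζ + ρ^β e^(bu) ⟨G, ∇ζ⟩) dv_g`. -/
noncomputable def hardyForm (u ρ : M → ℝ) (G : (x : M) → TangentSpace (𝓡 n) x) (a b c β : ℝ)
    (ζ : M → ℝ) : ℝ :=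
  ∫ x, (c * (ρ x ^ (β - 1) * Real.exp (u x) ^ a) * ζ x +
    ρ x ^ β * Real.exp (u x) ^ b * inner ℝ (G x) (gradient ζ x)) ∂riemannianVolume n M

variable [IsManifold (𝓡 n) ∞ M]
  [IsContMDiffRiemannianBundle (𝓡 n) ∞ (EuclideanSpace ℝ (Fin n))
    (fun x : M => TangentSpace (𝓡 n) x)]
  [T2Space M] [SecondCountableTopology M] [BorelSpace M]
  {u ρ : M → ℝ} {G : (x : M) → TangentSpace (𝓡 n) x} {a b m : ℝ}

theorem integrable_hardyForm_left (hu : ContMDiff (𝓡 n) 𝓘(ℝ, ℝ) ∞ u) (hρ : Continuous ρ)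
    (c β a : ℝ) {ζ : M → ℝ} (hζ : IsTestFunction n ρ ζ) :
    Integrable (fun x => c * (ρ x ^ β * Real.exp (u x) ^ a) * ζ x) (riemannianVolume n M) :=
  integrable_mul_of_tsupport ((measurable_rpow_mul_exp_rpow hu hρ β a).const_mul c)
    (continuousOn_const.mul (continuousOn_rpow_mul_exp_rpow hu hρ β a hζ.support))
    hζ.smooth.continuous hζ.compact

theorem integrable_hardyForm_right (hu : ContMDiff (𝓡 n) 𝓘(ℝ, ℝ) ∞ u) (hρ : Continuous ρ)
    (hG : HasWeakGradient ρ G)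
    (hGm : ∀ᵐ x ∂riemannianVolume n M, ‖G x‖ = Real.exp (u x) ^ m)
    (β b : ℝ) {ζ : M → ℝ} (hζ : IsTestFunction n ρ ζ) :
    Integrable (fun x => ρ x ^ β * Real.exp (u x) ^ b * inner ℝ (G x) (gradient ζ x))
      (riemannianVolume n M) :=
  integrable_mul_inner_gradient hG (contMDiff_exp_rpow hu m).continuous (hGm.mono fun _ h => h.le)
    hζ.smooth (measurable_rpow_mul_exp_rpow hu hρ β b) hζ.compact
    (continuousOn_rpow_mul_exp_rpow hu hρ β b hζ.support)
    fun x hx => by simp [gradient_eq_zero_of_notMem_tsupport hx]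

theorem integrable_hardyForm (hu : ContMDiff (𝓡 n) 𝓘(ℝ, ℝ) ∞ u) (hρ : Continuous ρ)
    (hG : HasWeakGradient ρ G)
    (hGm : ∀ᵐ x ∂riemannianVolume n M, ‖G x‖ = Real.exp (u x) ^ m)
    (a b c β : ℝ) {ζ : M → ℝ} (hζ : IsTestFunction n ρ ζ) :
    Integrable (fun x => c * (ρ x ^ (β - 1) * Real.exp (u x) ^ a) * ζ x +
      ρ x ^ β * Real.exp (u x) ^ b * inner ℝ (G x) (gradient ζ x)) (riemannianVolume n M) :=
  (integrable_hardyForm_left hu hρ c _ a hζ).add (integrable_hardyForm_right hu hρ hG hGm β b hζ)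

theorem hardyForm_add (hu : ContMDiff (𝓡 n) 𝓘(ℝ, ℝ) ∞ u) (hρ : Continuous ρ)
    (hG : HasWeakGradient ρ G)
    (hGm : ∀ᵐ x ∂riemannianVolume n M, ‖G x‖ = Real.exp (u x) ^ m)
    (a b c β : ℝ) {ζ ξ : M → ℝ} (hζ : IsTestFunction n ρ ζ) (hξ : IsTestFunction n ρ ξ) :
    hardyForm u ρ G a b c β (fun x => ζ x + ξ x) =
      hardyForm u ρ G a b c β ζ + hardyForm u ρ G a b c β ξ := by
  rw [hardyForm, hardyForm, hardyForm, ← integral_add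
    (integrable_hardyForm hu hρ hG hGm a b c β hζ) (integrable_hardyForm hu hρ hG hGm a b c β hξ)]
  refine integral_congr_ae (ae_of_all _ fun x => ?_)
  simp only
  rw [inner_gradient_add (hζ.smooth.mdifferentiable (by simp) x)
    (hξ.smooth.mdifferentiable (by simp) x)]
  ring

/-- Passing from the test function `ζ` to `ρ^β ζ`, for `ζ` supported in a chart. -/
theorem hardyForm_nonneg_in_chart (hu : ContMDiff (𝓡 n) 𝓘(ℝ, ℝ) ∞ u) (hρ : Continuous ρ)
    (hρ0 : ∀ x, 0 ≤ ρ x) (hG : HasWeakGradient ρ G)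
    (hGm : ∀ᵐ x ∂riemannianVolume n M, ‖G x‖ = Real.exp (u x) ^ m) (hab : b + 2 * m = a)
    {σ C : ℝ} (H : ∀ ζ : M → ℝ, IsTestFunction n ρ ζ → (∀ x, 0 ≤ ζ x) →
      0 ≤ σ * hardyForm u ρ G a b C 0 ζ) (β : ℝ)
    {e : OpenPartialHomeomorph M (EuclideanSpace ℝ (Fin n))}
    (he : e ∈ atlas (EuclideanSpace ℝ (Fin n)) M) {ζ : M → ℝ} (hζ : IsTestFunction n ρ ζ)
    (hζ0 : ∀ x, 0 ≤ ζ x) (hζe : tsupport ζ ⊆ e.source) :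
    0 ≤ σ * hardyForm u ρ G a b (C + β) β ζ := by
  set K := tsupport ζ with hKdef
  have hK : IsCompact K := hζ.compact
  have hN := (contMDiff_exp_rpow hu m).continuous
  have hGN := hGm.mono fun _ h => h.le
  have hpos : ∀ x ∈ K, 0 < ρ x := fun x hx => (hρ0 x).lt_of_ne' (hζ.support hx)
  -- As `ρ ^ β * ζ` need not be smooth, `H` is applied to `r k ^ β * ζ` and the limit is taken.
  obtain ⟨r, a₀, b₀, B, ha₀, hr, hab₀, hae⟩ :=
    exists_approx_in_chart hρ hG hN hGN he hK hζe hpos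
  have hrpos : ∀ k, ∀ x ∈ K, 0 < r k x := fun k x hx => ha₀.trans_le (hab₀ k x hx).1
  have hrat : ∀ k, ∀ x ∈ K, ContMDiffAt (𝓡 n) 𝓘(ℝ, ℝ) ∞ (r k) x := fun k x hx =>
    (hr k).contMDiffAt (e.open_source.mem_nhds (hζe hx))
  have hη : ∀ k, IsTestFunction n ρ fun x => r k x ^ β * ζ x := fun k =>
    hζ.of_mul (f := fun x => r k x ^ β) fun x hx =>
      (Real.contDiffAt_rpow_const_of_ne (hrpos k x hx).ne').contMDiffAt.comp x (hrat k x hx)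
  have hη0 : ∀ k x, 0 ≤ r k x ^ β * ζ x := fun k x => by
    by_cases hx : x ∈ K
    · exact mul_nonneg (Real.rpow_nonneg (hrpos k x hx).le _) (hζ0 x)
    · simp [image_eq_zero_of_notMem_tsupport hx]
  have hgr : ∀ k, ∀ x ∈ K, (inner ℝ (G x) (gradient (fun y => r k y ^ β * ζ y) x) : ℝ) =
      r k x ^ β * inner ℝ (G x) (gradient ζ x) +
        ζ x * (β * r k x ^ (β - 1) * inner ℝ (G x) (gradient (r k) x)) := fun k x hx => by
    have hd := (hrat k x hx).mdifferentiableAt (by simp)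
    have hh := Real.hasDerivAt_rpow_const (p := β) (Or.inl (hrpos k x hx).ne')
    have hd' : MDifferentiableAt (𝓡 n) 𝓘(ℝ, ℝ) (fun y => r k y ^ β) x :=
      hh.differentiableAt.mdifferentiableAt.comp x hd
    rw [inner_gradient_mul hd' (hζ.smooth.mdifferentiable (by simp) x), inner_gradient_comp hd hh]
  -- The values of `r k` on `K` lie in a fixed interval away from 0, so negative powers are
  -- uniformly bounded too.
  have hbd : ∀ γ : ℝ, ∃ c, 0 ≤ c ∧ ∀ k, ∀ x ∈ K, |r k x ^ γ| ≤ c := fun γ => by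
    obtain ⟨c, hc0, hc⟩ := exists_abs_le_of_continuousOn (isCompact_Icc (a := a₀) (b := b₀))
      (A := fun t => t ^ γ) (continuousOn_id.rpow_const fun t ht => Or.inl (ha₀.trans_le ht.1).ne')
    exact ⟨c, hc0, fun k x hx => hc _ (hab₀ k x hx)⟩
  obtain ⟨c₁, hc₁0, hc₁⟩ := hbd β
  obtain ⟨c₂, hc₂0, hc₂⟩ := hbd (β - 1)
  obtain ⟨B₁, hB₁0, hB₁⟩ := exists_abs_le_of_continuousOn hK
    (A := fun x => C * (ρ x ^ ((0 : ℝ) - 1) * Real.exp (u x) ^ a))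
    (continuousOn_const.mul (continuousOn_rpow_mul_exp_rpow hu hρ (0 - 1) a hζ.support))
  obtain ⟨B₂, hB₂0, hB₂⟩ := exists_abs_le_of_continuousOn hK
    (continuousOn_rpow_mul_exp_rpow hu hρ 0 b hζ.support)
  obtain ⟨B₃, hB₃0, hB₃⟩ := exists_abs_le_of_continuousOn hK hζ.smooth.continuous.continuousOn
  obtain ⟨B₄, hB₄0, hB₄⟩ := abs_inner_gradient_le_on_compact hN hGN hζ.smooth hK
  have hlim : Tendsto (fun k => hardyForm u ρ G a b C 0 fun x => r k x ^ β * ζ x) atTop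
      (𝓝 (hardyForm u ρ G a b (C + β) β ζ)) := by
    refine tendsto_integral_of_bounded_on_compact hK (fun k => ?_) (fun k x hx => ?_)
      (fun x hx => ?_) (B := B₁ * (c₁ * B₃) + B₂ * (c₁ * B₄ + B₃ * (|β| * c₂ * B))) ?_ ?_
    · exact (integrable_hardyForm hu hρ hG hGm a b C 0 (hη k)).aestronglyMeasurable
    · have h1 : x ∉ tsupport fun x => r k x ^ β * ζ x := fun h =>
        hx (tsupport_mul_subset_right h)
      simp [image_eq_zero_of_notMem_tsupport hx, gradient_eq_zero_of_notMem_tsupport h1]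
    · simp [image_eq_zero_of_notMem_tsupport hx, gradient_eq_zero_of_notMem_tsupport hx]
    · filter_upwards [hae, hB₄] with x hx hx4 hxK k
      rw [hgr k x hxK]
      refine (abs_add_le _ _).trans (add_le_add ?_ ?_)
      · rw [abs_mul, abs_mul (r k x ^ β)]
        have h1 := hB₁ x hxK
        have h2 := hB₃ x hxK
        have h3 := hc₁ k x hxK
        gcongr
      · rw [abs_mul]
        have h1 := hB₂ x hxK
        refine mul_le_mul h1 ((abs_add_le _ _).trans (add_le_add ?_ ?_)) (abs_nonneg _) hB₂0
        · rw [abs_mul]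
          exact mul_le_mul (hc₁ k x hxK) (hx4 hxK) (abs_nonneg _) hc₁0
        · rw [abs_mul, abs_mul, abs_mul]
          have h2 := hB₃ x hxK
          have h3 := hc₂ k x hxK
          have h4 := (hx hxK).2.2 k
          gcongr
    · filter_upwards [hae, hGm] with x hx hxm hxK
      obtain ⟨hx1, hx2, -⟩ := hx hxK
      have hρx := hpos x hxK
      have hl : ∀ γ : ℝ, Tendsto (fun k => r k x ^ γ) atTop (𝓝 (ρ x ^ γ)) := fun γ =>
        hx1.rpow_const (Or.inl hρx.ne')
      have hlim := (((hl β).mul_const (ζ x)).const_mul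
        (C * (ρ x ^ ((0 : ℝ) - 1) * Real.exp (u x) ^ a))).add
        ((((hl β).mul_const (inner ℝ (G x) (gradient ζ x))).add
          ((((hl (β - 1)).const_mul β).mul hx2).const_mul (ζ x))).const_mul
          (ρ x ^ (0 : ℝ) * Real.exp (u x) ^ b))
      simp only [hgr _ x hxK]
      convert hlim using 2
      have e1 : ρ x ^ (β - 1) = ρ x ^ ((0 : ℝ) - 1) * ρ x ^ β := by
        rw [← Real.rpow_add hρx]; congr 1; ring
      -- Here `|G|² = V^(2m)` and `b + 2m = a` enter: the term from differentiating `ρ^β` acquires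
      -- the weight `V^a` and merges with the `C` term into `C + β`.
      have e2 : Real.exp (u x) ^ a = Real.exp (u x) ^ b * (inner ℝ (G x) (G x) : ℝ) := by
        rw [real_inner_self_eq_norm_sq, hxm, ← Real.rpow_natCast, ← Real.rpow_mul (Real.exp_pos _).le,
          ← Real.rpow_add (Real.exp_pos _)]
        congr 1
        push_cast
        linarith
      rw [Real.rpow_zero, e1, e2]
      ring
  exact ge_of_tendsto' (hlim.const_mul σ) fun k => H _ (hη k) (hη0 k)

/-- The form is additive in `ζ`, and a partition of unity subordinate to the charts cuts `ζ` into
finitely many nonnegative pieces, each supported in one chart, where mollification is available. -/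
theorem hardyForm_nonneg (hu : ContMDiff (𝓡 n) 𝓘(ℝ, ℝ) ∞ u) (hρ : Continuous ρ)
    (hρ0 : ∀ x, 0 ≤ ρ x) (hG : HasWeakGradient ρ G)
    (hGm : ∀ᵐ x ∂riemannianVolume n M, ‖G x‖ = Real.exp (u x) ^ m) (hab : b + 2 * m = a)
    {σ C : ℝ} (H : ∀ ζ : M → ℝ, IsTestFunction n ρ ζ → (∀ x, 0 ≤ ζ x) →
      0 ≤ σ * hardyForm u ρ G a b C 0 ζ) (β : ℝ) {ζ : M → ℝ} (hζ : IsTestFunction n ρ ζ)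
    (hζ0 : ∀ x, 0 ≤ ζ x) : 0 ≤ σ * hardyForm u ρ G a b (C + β) β ζ := by
  have : LocallyCompactSpace M := Manifold.locallyCompact_of_finiteDimensional (𝓡 n)
  obtain ⟨χ, hχ⟩ := SmoothPartitionOfUnity.exists_isSubordinate (𝓡 n) (isClosed_tsupport ζ)
    (fun x : M => (chartAt (EuclideanSpace ℝ (Fin n)) x).source)
    (fun x => (chartAt (EuclideanSpace ℝ (Fin n)) x).open_source)
    fun x _ => mem_iUnion.2 ⟨x, mem_chart_source _ x⟩
  have hfin : {i | ((Function.support (χ i)) ∩ tsupport ζ).Nonempty}.Finite :=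
    χ.locallyFinite.finite_nonempty_inter_compact hζ.compact
  have hsum : ζ = fun x => ∑ i ∈ hfin.toFinset, χ i x * ζ x := by
    funext x
    by_cases hx : x ∈ tsupport ζ
    · rw [← Finset.sum_mul, ← finsum_eq_sum_of_support_subset, χ.sum_eq_one hx, one_mul]
      intro i hi
      simpa using ⟨x, hi, hx⟩
    · simp [image_eq_zero_of_notMem_tsupport hx]
  have hχζ : ∀ i, IsTestFunction n ρ fun x => χ i x * ζ x := fun i =>
    hζ.of_mul fun x _ => (χ i).contMDiff.contMDiffAt
  -- Being a test function is carried through the induction because additivity of the form requires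
  -- it of both summands.
  have key : ∀ s : Finset M, IsTestFunction n ρ (fun x => ∑ i ∈ s, χ i x * ζ x) ∧
      0 ≤ σ * hardyForm u ρ G a b (C + β) β (fun x => ∑ i ∈ s, χ i x * ζ x) := by
    classical
    intro s
    induction s using Finset.induction_on with
    | empty =>
      have h0 : IsTestFunction n ρ fun _ : M => (0 : ℝ) :=
        hζ.comp_left (h := fun _ => 0) contDiff_const rfl
      have h1 : ∀ x, gradient (n := n) (fun _ : M => (0 : ℝ)) x = 0 := fun x =>
        gradient_eq_zero_of_notMem_tsupport (by simp [tsupport_eq_empty_iff.2 (rfl : (fun _ : M => (0 : ℝ)) = 0)])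
      simp only [Finset.sum_empty]
      exact ⟨h0, by simp [hardyForm, h1]⟩
    | insert i s hi ih =>
      simp only [Finset.sum_insert hi]
      refine ⟨(hχζ i).add ih.1, ?_⟩
      rw [hardyForm_add hu hρ hG hGm a b _ β (hχζ i) ih.1, mul_add]
      refine add_nonneg ?_ ih.2
      refine hardyForm_nonneg_in_chart hu hρ hρ0 hG hGm hab H β (chart_mem_atlas _ i) (hχζ i)
        (fun x => mul_nonneg (χ.nonneg i x) (hζ0 x)) ?_
      exact tsupport_mul_subset_left.trans (hχ i)
  rw [hsum]
  exact (key _).2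

end HardyForm

/-! ### Smooth approximation of `|t|^p`, with bounds uniform in the parameter. -/

section SmoothPower

open Filter Topology

/-- A smooth approximation `(t² + δ)^(p/2) - δ^(p/2)` of `|t|^p`. -/
noncomputable def smoothPow (p δ t : ℝ) : ℝ := (t ^ 2 + δ) ^ (p / 2) - δ ^ (p / 2)

variable {p δ : ℝ}

theorem contDiff_smoothPow (hδ : 0 < δ) : ContDiff ℝ ∞ (smoothPow p δ) := by
  unfold smoothPow
  exact ((((contDiff_id.pow 2).add contDiff_const).rpow_const_of_ne fun t =>
    (by positivity : (0:ℝ) < t ^ 2 + δ).ne').sub contDiff_const)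

/-- The purpose of subtracting `δ ^ (p / 2)`: composing with a function that vanishes at 0 does not
enlarge the support of `φ`. -/
theorem smoothPow_zero : smoothPow p δ 0 = 0 := by simp [smoothPow]

theorem smoothPow_nonneg (hp : 0 ≤ p) (hδ : 0 < δ) (t : ℝ) : 0 ≤ smoothPow p δ t :=
  sub_nonneg.2 (Real.rpow_le_rpow hδ.le (by nlinarith [sq_nonneg t]) (by positivity))

theorem smoothPow_le (hp : 0 ≤ p) (hδ : 0 < δ) (hδ1 : δ ≤ 1) {t b : ℝ} (ht : |t| ≤ b) :
    smoothPow p δ t ≤ (b ^ 2 + 1) ^ (p / 2) := by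
  have h1 : t ^ 2 ≤ b ^ 2 := sq_le_sq' (abs_le.1 ht).1 (abs_le.1 ht).2
  have h2 : (t ^ 2 + δ) ^ (p / 2) ≤ (b ^ 2 + 1) ^ (p / 2) :=
    Real.rpow_le_rpow (by positivity) (by linarith) (by positivity)
  have h3 : 0 ≤ δ ^ (p / 2) := by positivity
  rw [smoothPow]
  linarith

theorem hasDerivAt_smoothPow (hδ : 0 < δ) (t : ℝ) :
    HasDerivAt (smoothPow p δ) (p * (t * (t ^ 2 + δ) ^ (p / 2 - 1))) t := by
  have h1 : HasDerivAt (fun t : ℝ => t ^ 2 + δ) (2 * t) t := by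
    simpa using (hasDerivAt_pow 2 t).add_const δ
  have h2 := (h1.rpow_const (p := p / 2)
    (Or.inl (by positivity : (0:ℝ) < t ^ 2 + δ).ne')).sub_const (δ ^ (p / 2))
  rw [show p * (t * (t ^ 2 + δ) ^ (p / 2 - 1)) = 2 * t * (p / 2) * (t ^ 2 + δ) ^ (p / 2 - 1) by ring]
  exact h2

/-- For `p < 2` the exponent `p / 2 - 1` is negative; absorbing `|t| ≤ (t² + δ)^(1/2)` leaves the
positive exponent `(p - 1) / 2`, hence a bound independent of `δ`. -/
theorem abs_mul_rpow_le (hp : 1 < p) (hδ : 0 < δ) (hδ1 : δ ≤ 1) {t b : ℝ} (ht : |t| ≤ b) :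
    |t * (t ^ 2 + δ) ^ (p / 2 - 1)| ≤ (b ^ 2 + 1) ^ ((p - 1) / 2) := by
  have h0 : 0 < t ^ 2 + δ := by positivity
  have h1 : t ^ 2 ≤ b ^ 2 := sq_le_sq' (abs_le.1 ht).1 (abs_le.1 ht).2
  have h2 : |t| ≤ (t ^ 2 + δ) ^ (1 / 2 : ℝ) := by
    rw [← Real.sqrt_eq_rpow]
    exact Real.abs_le_sqrt (by linarith)
  rw [abs_mul, abs_of_pos (Real.rpow_pos_of_pos h0 _)]
  calc |t| * (t ^ 2 + δ) ^ (p / 2 - 1) ≤ (t ^ 2 + δ) ^ (1 / 2 : ℝ) * (t ^ 2 + δ) ^ (p / 2 - 1) := by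
        gcongr
    _ = (t ^ 2 + δ) ^ ((p - 1) / 2) := by
        rw [← Real.rpow_add h0]; congr 1; ring
    _ ≤ _ := Real.rpow_le_rpow h0.le (by linarith) (by linarith)

theorem tendsto_smoothPow (hp : 0 < p) (t : ℝ) {δ : ℕ → ℝ} (hδ : Tendsto δ atTop (𝓝 0)) :
    Tendsto (fun k => smoothPow p (δ k) t) atTop (𝓝 (|t| ^ p)) := by
  have h1 : Tendsto (fun k => (t ^ 2 + δ k) ^ (p / 2)) atTop (𝓝 ((t ^ 2 + 0) ^ (p / 2))) :=
    (tendsto_const_nhds.add hδ).rpow_const (Or.inr (by positivity))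
  have h2 : Tendsto (fun k => δ k ^ (p / 2)) atTop (𝓝 (0 ^ (p / 2))) :=
    hδ.rpow_const (Or.inr (by positivity))
  have h3 : |t| ^ p = (t ^ 2 + 0) ^ (p / 2) - 0 ^ (p / 2) := by
    rw [Real.zero_rpow (by positivity), add_zero, sub_zero, ← sq_abs, ← Real.rpow_natCast,
      ← Real.rpow_mul (abs_nonneg _)]
    congr 1
    push_cast
    ring
  rw [h3]
  exact h1.sub h2

/-- The power may be singular at 0, but there the factor `t` makes every term vanish. -/
theorem tendsto_mul_rpow (t : ℝ) {δ : ℕ → ℝ} (hδ : Tendsto δ atTop (𝓝 0)) :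
    Tendsto (fun k => t * (t ^ 2 + δ k) ^ (p / 2 - 1)) atTop (𝓝 (t * (t ^ 2) ^ (p / 2 - 1))) := by
  rcases eq_or_ne t 0 with rfl | ht
  · simp
  · have h1 : Tendsto (fun k => (t ^ 2 + δ k) ^ (p / 2 - 1)) atTop
        (𝓝 ((t ^ 2 + 0) ^ (p / 2 - 1))) :=
      (tendsto_const_nhds.add hδ).rpow_const (Or.inl (by positivity))
    rw [add_zero] at h1
    exact h1.const_mul t

theorem abs_mul_sq_rpow (hp : 1 < p) (t : ℝ) : |t * (t ^ 2) ^ (p / 2 - 1)| = |t| ^ (p - 1) := by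
  rcases eq_or_ne t 0 with rfl | ht
  · simp [Real.zero_rpow (by linarith : p - 1 ≠ 0)]
  · rw [abs_mul, abs_of_nonneg (Real.rpow_nonneg (sq_nonneg t) _), ← sq_abs, ← Real.rpow_natCast,
      ← Real.rpow_mul (abs_nonneg _)]
    conv_lhs => rw [← Real.rpow_one |t|]
    rw [Real.rpow_one, ← Real.rpow_one_add' (abs_nonneg t)]
    · congr 1; push_cast; ring
    · push_cast; linarith

end SmoothPower

/-- Young's inequality with weights that are powers of `r`. -/
theorem young_rpow_weight {p α r f q t : ℝ} (hp : 1 < p) (hr : 0 < r) (hf : 0 ≤ f) (hq : 0 ≤ q)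
    (ht : 0 < t) : p * t ^ (p - 1) * (r ^ (α + 1) * f ^ (p - 1) * q) ≤
      (p - 1) * t ^ p * (r ^ α * f ^ p) + r ^ (α + p) * q ^ p := by
  have hp0 : 0 < p := by linarith
  have hp1 : 0 < p - 1 := by linarith
  have hpq : (p / (p - 1)).HolderConjugate p :=
    (Real.HolderConjugate.conjExponent hp).symm
  -- The factors come from `α + 1 = (α / p)(p - 1) + (α + p) / p`: raised to the exponents `p / (p -
  -- 1)` and `p`, they give `r ^ α` and `r ^ (α + p)`.
  have h := Real.young_inequality_of_nonneg
    (a := (t * (r ^ (α / p) * f)) ^ (p - 1)) (b := r ^ ((α + p) / p) * q)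
    (by positivity) (by positivity) hpq
  rw [← Real.rpow_mul (by positivity), mul_div_cancel₀ _ hp1.ne', Real.mul_rpow ht.le (by positivity),
    Real.mul_rpow (by positivity) hf, Real.mul_rpow ht.le (by positivity),
    Real.mul_rpow (by positivity) hf, Real.mul_rpow (by positivity) hq,
    ← Real.rpow_mul hr.le, ← Real.rpow_mul hr.le, ← Real.rpow_mul hr.le, div_mul_cancel₀ _ hp0.ne',
    div_mul_cancel₀ _ hp0.ne'] at h
  have e : r ^ (α + 1) = r ^ (α / p * (p - 1)) * r ^ ((α + p) / p) := by
    rw [← Real.rpow_add hr]; congr 1; field_simp; ring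
  rw [e]
  have h2 := mul_le_mul_of_nonneg_left h hp0.le
  have h3 : p * (t ^ p * (r ^ α * f ^ p) / (p / (p - 1)) + r ^ (α + p) * q ^ p / p) =
      (p - 1) * t ^ p * (r ^ α * f ^ p) + r ^ (α + p) * q ^ p := by
    field_simp
  rw [h3] at h2
  refine le_trans (le_of_eq ?_) h2
  ring

/-! ### From the sign of the form to the weighted Hardy inequality. -/

section HardyInequality

open Filter Topology

variable {n : ℕ} {M : Type*} [TopologicalSpace M]
  [ChartedSpace (EuclideanSpace ℝ (Fin n)) M]
  [RiemannianBundle (fun x : M => TangentSpace (𝓡 n) x)] [MeasurableSpace M]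
  [IsManifold (𝓡 n) ∞ M]
  [IsContMDiffRiemannianBundle (𝓡 n) ∞ (EuclideanSpace ℝ (Fin n))
    (fun x : M => TangentSpace (𝓡 n) x)]
  [T2Space M] [SecondCountableTopology M] [BorelSpace M]
  {u ρ : M → ℝ} {G : (x : M) → TangentSpace (𝓡 n) x} {a b m : ℝ}

theorem integrable_weight_mul_abs_rpow (hu : ContMDiff (𝓡 n) 𝓘(ℝ, ℝ) ∞ u) (hρ : Continuous ρ)
    (β a : ℝ) {p : ℝ} (hp : 0 < p) {φ : M → ℝ} (hφ : IsTestFunction n ρ φ) :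
    Integrable (fun x => ρ x ^ β * Real.exp (u x) ^ a * |φ x| ^ p) (riemannianVolume n M) := by
  obtain ⟨B, hB0, hB⟩ := exists_abs_le_of_continuousOn hφ.compact
    ((continuousOn_rpow_mul_exp_rpow hu hρ β a hφ.support).mul
      (hφ.smooth.continuous.abs.rpow_const fun _ => Or.inr hp.le).continuousOn)
  refine integrable_of_bounded_on_compact hφ.compact ((measurable_rpow_mul_exp_rpow hu hρ β a).mul
    (hφ.smooth.continuous.abs.measurable.pow_const p)).aestronglyMeasurable (fun x hx => ?_)
    (ae_of_all _ hB)
  simp [image_eq_zero_of_notMem_tsupport hx, Real.zero_rpow hp.ne']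

theorem integrable_weight_mul_abs_inner_gradient_rpow (hu : ContMDiff (𝓡 n) 𝓘(ℝ, ℝ) ∞ u)
    (hρ : Continuous ρ) (hG : HasWeakGradient ρ G)
    (hGm : ∀ᵐ x ∂riemannianVolume n M, ‖G x‖ = Real.exp (u x) ^ m) (β a : ℝ) {p q : ℝ}
    (hp : 0 < p) (hq : 0 ≤ q) {φ : M → ℝ} (hφ : IsTestFunction n ρ φ) :
    Integrable (fun x => ρ x ^ β * Real.exp (u x) ^ a * |φ x| ^ q *
      |(inner ℝ (G x) (gradient φ x) : ℝ)| ^ p) (riemannianVolume n M) := by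
  obtain ⟨B, hB0, hB⟩ := exists_abs_le_of_continuousOn hφ.compact
    ((continuousOn_rpow_mul_exp_rpow hu hρ β a hφ.support).mul
      (hφ.smooth.continuous.abs.rpow_const fun _ => Or.inr hq).continuousOn)
  obtain ⟨B', hB'0, hB'⟩ := abs_inner_gradient_le_on_compact (contMDiff_exp_rpow hu m).continuous
    (hGm.mono fun _ h => h.le) hφ.smooth hφ.compact
  refine integrable_of_bounded_on_compact hφ.compact (((measurable_rpow_mul_exp_rpow hu hρ β a).mul
    (hφ.smooth.continuous.abs.measurable.pow_const q)).aestronglyMeasurable.mul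
    ((aestronglyMeasurable_inner_gradient hG hφ.smooth).aemeasurable.abs.pow_const
      p).aestronglyMeasurable) (fun x hx => ?_) (B := B * B' ^ p) ?_
  · simp [gradient_eq_zero_of_notMem_tsupport hx, Real.zero_rpow hp.ne']
  · filter_upwards [hB'] with x hx hxK
    rw [abs_mul, abs_of_nonneg (Real.rpow_nonneg (abs_nonneg (inner ℝ (G x) (gradient φ x))) p)]
    exact mul_le_mul (hB x hxK) (Real.rpow_le_rpow (abs_nonneg _) (hx hxK) hp.le) (by positivity)
      hB0

/-- This is the form tested on `|φ|^p`, reached as the limit of `smoothPow`. The condition `σ * c =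
-|c|` makes the zeroth-order term negative, so it moves to the left; `|σ| = 1` lets the gradient
term be bounded by its absolute value. -/
theorem abs_mul_integral_le_of_hardyForm_nonneg (hu : ContMDiff (𝓡 n) 𝓘(ℝ, ℝ) ∞ u)
    (hρ : Continuous ρ) (hρ0 : ∀ x, 0 ≤ ρ x) (hG : HasWeakGradient ρ G)
    (hGm : ∀ᵐ x ∂riemannianVolume n M, ‖G x‖ = Real.exp (u x) ^ m) {σ c β p : ℝ} (hp : 1 < p)
    (hσ : |σ| = 1) (hσc : σ * c = -|c|)
    (H : ∀ ζ : M → ℝ, IsTestFunction n ρ ζ → (∀ x, 0 ≤ ζ x) → 0 ≤ σ * hardyForm u ρ G a b c β ζ)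
    {φ : M → ℝ} (hφ : IsTestFunction n ρ φ) :
    |c| * ∫ x, ρ x ^ (β - 1) * Real.exp (u x) ^ a * |φ x| ^ p ∂riemannianVolume n M ≤
      p * ∫ x, ρ x ^ β * Real.exp (u x) ^ b * |φ x| ^ (p - 1) *
        |(inner ℝ (G x) (gradient φ x) : ℝ)| ∂riemannianVolume n M := by
  have hp0 : 0 < p := by linarith
  set K := tsupport φ with hKdef
  have hK : IsCompact K := hφ.compact
  let δ : ℕ → ℝ := fun k => 1 / ((k : ℝ) + 1)
  have hδ0 : ∀ k, 0 < δ k := fun k => by positivity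
  have hδ1 : ∀ k, δ k ≤ 1 := fun k => by
    rw [div_le_one (by positivity)]
    linarith [k.cast_nonneg (α := ℝ)]
  have hδ : Tendsto δ atTop (𝓝 0) := tendsto_one_div_add_atTop_nhds_zero_nat
  have hζ : ∀ k, IsTestFunction n ρ fun x => smoothPow p (δ k) (φ x) := fun k =>
    hφ.comp_left (contDiff_smoothPow (hδ0 k)) smoothPow_zero
  have hgr : ∀ k x, (inner ℝ (G x) (gradient (fun x => smoothPow p (δ k) (φ x)) x) : ℝ) =
      p * (φ x * (φ x ^ 2 + δ k) ^ (p / 2 - 1)) * inner ℝ (G x) (gradient φ x) := fun k x =>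
    inner_gradient_comp (hφ.smooth.mdifferentiable (by simp) x) (hasDerivAt_smoothPow (hδ0 k) _) _
  obtain ⟨B₁, hB₁0, hB₁⟩ := exists_abs_le_of_continuousOn hK
    (A := fun x => c * (ρ x ^ (β - 1) * Real.exp (u x) ^ a))
    (continuousOn_const.mul (continuousOn_rpow_mul_exp_rpow hu hρ (β - 1) a hφ.support))
  obtain ⟨B₂, hB₂0, hB₂⟩ := exists_abs_le_of_continuousOn hK
    (continuousOn_rpow_mul_exp_rpow hu hρ β b hφ.support)
  obtain ⟨B₃, hB₃0, hB₃⟩ := exists_abs_le_of_continuousOn hK hφ.smooth.continuous.continuousOn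
  obtain ⟨B₄, hB₄0, hB₄⟩ := abs_inner_gradient_le_on_compact (contMDiff_exp_rpow hu m).continuous
    (hGm.mono fun _ h => h.le) hφ.smooth hK
  have hlim : Tendsto (fun k => hardyForm u ρ G a b c β fun x => smoothPow p (δ k) (φ x)) atTop
      (𝓝 (∫ x, (c * (ρ x ^ (β - 1) * Real.exp (u x) ^ a) * |φ x| ^ p + ρ x ^ β * Real.exp (u x) ^ b *
        (p * (φ x * (φ x ^ 2) ^ (p / 2 - 1)) * inner ℝ (G x) (gradient φ x)))
        ∂riemannianVolume n M)) := by
    refine tendsto_integral_of_bounded_on_compact hK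
      (fun k => (integrable_hardyForm hu hρ hG hGm a b c β (hζ k)).aestronglyMeasurable)
      (fun k x hx => ?_) (fun x hx => ?_) (B := B₁ * (B₃ ^ 2 + 1) ^ (p / 2) +
        B₂ * (p * (B₃ ^ 2 + 1) ^ ((p - 1) / 2) * B₄)) ?_ (ae_of_all _ fun x hx => ?_)
    · rw [hgr]
      simp [image_eq_zero_of_notMem_tsupport hx, smoothPow_zero]
    · simp [image_eq_zero_of_notMem_tsupport hx, hp0.ne']
    · filter_upwards [hB₄] with x hx hxK k
      rw [hgr]
      refine (abs_add_le _ _).trans (add_le_add ?_ ?_)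
      · rw [abs_mul, abs_of_nonneg (smoothPow_nonneg hp0.le (hδ0 k) _)]
        exact mul_le_mul (hB₁ x hxK) (smoothPow_le hp0.le (hδ0 k) (hδ1 k) (hB₃ x hxK))
          (smoothPow_nonneg hp0.le (hδ0 k) _) hB₁0
      · rw [abs_mul]
        refine mul_le_mul (hB₂ x hxK) ?_ (abs_nonneg _) hB₂0
        rw [abs_mul, abs_mul, abs_of_pos hp0]
        have h1 := abs_mul_rpow_le hp (hδ0 k) (hδ1 k) (hB₃ x hxK)
        have h2 := hx hxK
        gcongr
    · simp only [hgr]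
      exact ((tendsto_smoothPow hp0 (φ x) hδ).const_mul _).add
        ((((tendsto_mul_rpow (φ x) hδ).const_mul p).mul_const _).const_mul _)
  have hnn := ge_of_tendsto' (hlim.const_mul σ) fun k =>
    H _ (hζ k) fun x => smoothPow_nonneg hp0.le (hδ0 k) _
  have hi1 := integrable_weight_mul_abs_rpow hu hρ (β - 1) a hp0 hφ
  have hi2 : Integrable (fun x => ρ x ^ β * Real.exp (u x) ^ b * |φ x| ^ (p - 1) *
      |(inner ℝ (G x) (gradient φ x) : ℝ)|) (riemannianVolume n M) := by
    simpa using integrable_weight_mul_abs_inner_gradient_rpow hu hρ hG hGm β b one_pos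
      (by linarith : 0 ≤ p - 1) hφ
  rw [← integral_const_mul, ← integral_const_mul, ← sub_nonneg, ← integral_sub (hi2.const_mul p)
    (hi1.const_mul |c|)]
  rw [← integral_const_mul] at hnn
  have hi3 := (hi2.const_mul p).sub (hi1.const_mul |c|)
  have hw : ∀ x, 0 ≤ ρ x ^ β * Real.exp (u x) ^ b := fun x =>
    mul_nonneg (Real.rpow_nonneg (hρ0 x) _) (Real.rpow_nonneg (Real.exp_pos _).le _)
  have habs : ∀ x, |ρ x ^ β * Real.exp (u x) ^ b *
      (p * (φ x * (φ x ^ 2) ^ (p / 2 - 1)) * inner ℝ (G x) (gradient φ x))| =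
      p * (ρ x ^ β * Real.exp (u x) ^ b * |φ x| ^ (p - 1) *
        |(inner ℝ (G x) (gradient φ x) : ℝ)|) := fun x => by
    rw [abs_mul, abs_of_nonneg (hw x), abs_mul, abs_mul, abs_mul_sq_rpow hp, abs_of_pos hp0]
    ring
  have hφm := hφ.smooth.continuous.measurable
  have hi4 : Integrable (fun x => ρ x ^ β * Real.exp (u x) ^ b *
      (p * (φ x * (φ x ^ 2) ^ (p / 2 - 1)) * inner ℝ (G x) (gradient φ x)))
      (riemannianVolume n M) := by
    refine (hi2.const_mul p).mono' ?_ (ae_of_all _ fun x => (habs x).le)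
    refine (measurable_rpow_mul_exp_rpow hu hρ β b).aestronglyMeasurable.mul
      (Measurable.aestronglyMeasurable ?_ |>.mul (aestronglyMeasurable_inner_gradient hG hφ.smooth))
    exact (hφm.mul ((hφm.pow_const 2).pow_const _)).const_mul p
  have hi5 : Integrable (fun x => c * (ρ x ^ (β - 1) * Real.exp (u x) ^ a) * |φ x| ^ p)
      (riemannianVolume n M) := by
    simpa only [mul_assoc] using hi1.const_mul c
  refine hnn.trans (integral_mono ((hi5.add hi4).const_mul σ) hi3 fun x => ?_)
  have h2 := (le_abs_self _).trans (abs_mul σ (ρ x ^ β * Real.exp (u x) ^ b *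
      (p * (φ x * (φ x ^ 2) ^ (p / 2 - 1)) * inner ℝ (G x) (gradient φ x)))).le
  rw [hσ, one_mul, habs] at h2
  linear_combination h2 + (ρ x ^ (β - 1) * Real.exp (u x) ^ a * |φ x| ^ p) * hσc

/-- The weighted Hardy inequality for a sign `σ` of the inequality of distributions. -/
theorem hardy_of_hardyForm_nonneg (hu : ContMDiff (𝓡 n) 𝓘(ℝ, ℝ) ∞ u)
    (hρ : Continuous ρ) (hρ0 : ∀ x, 0 ≤ ρ x) (hG : HasWeakGradient ρ G)
    (hGm : ∀ᵐ x ∂riemannianVolume n M, ‖G x‖ = Real.exp (u x) ^ m) (hab : b + 2 * m = a)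
    {σ C α p : ℝ} (hp : 1 < p) (hσ : |σ| = 1) (hσc : σ * (C + α + 1) = -|C + α + 1|)
    (hc : C + α + 1 ≠ 0)
    (H : ∀ ζ : M → ℝ, IsTestFunction n ρ ζ → (∀ x, 0 ≤ ζ x) → 0 ≤ σ * hardyForm u ρ G a b C 0 ζ)
    {φ : M → ℝ} (hφ : IsTestFunction n ρ φ) :
    (|C + α + 1| / p) ^ p * ∫ x, ρ x ^ α * Real.exp (u x) ^ a * |φ x| ^ p ∂riemannianVolume n M ≤
      ∫ x, ρ x ^ (α + p) * Real.exp (u x) ^ (a - 2 * m * p) *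
        |(inner ℝ (G x) (gradient φ x) : ℝ)| ^ p ∂riemannianVolume n M := by
  have hp0 : 0 < p := by linarith
  -- The choice `β = α + 1` turns `ρ^(β-1)` into `ρ^α` and `C + β` into the constant of the theorem.
  have h1 := abs_mul_integral_le_of_hardyForm_nonneg hu hρ hρ0 hG hGm (a := a) (b := b)
    (c := C + (α + 1)) (β := α + 1) hp hσ (by rwa [← add_assoc])
    (fun ζ hζ hζ0 => hardyForm_nonneg hu hρ hρ0 hG hGm hab H (α + 1) hζ hζ0) hφ
  rw [← add_assoc, add_sub_cancel_right] at h1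
  set t := |C + α + 1| / p with ht
  have ht0 : 0 < t := div_pos (abs_pos.2 hc) hp0
  have hct : |C + α + 1| = p * t := by rw [ht]; field_simp
  have hi1 := integrable_weight_mul_abs_rpow hu hρ α a hp0 hφ
  have hi2 : Integrable (fun x => ρ x ^ (α + 1) * Real.exp (u x) ^ b * |φ x| ^ (p - 1) *
      |(inner ℝ (G x) (gradient φ x) : ℝ)|) (riemannianVolume n M) := by
    simpa using integrable_weight_mul_abs_inner_gradient_rpow hu hρ hG hGm (α + 1) b one_pos
      (by linarith : 0 ≤ p - 1) hφ
  have hi3 : Integrable (fun x => ρ x ^ (α + p) * Real.exp (u x) ^ (a - 2 * m * p) *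
      |(inner ℝ (G x) (gradient φ x) : ℝ)| ^ p) (riemannianVolume n M) := by
    simpa using integrable_weight_mul_abs_inner_gradient_rpow hu hρ hG hGm (α + p)
      (a - 2 * m * p) hp0 le_rfl hφ
  have hle := integral_mono (hi2.const_mul (p * t ^ (p - 1)))
    ((hi1.const_mul ((p - 1) * t ^ p)).add hi3) fun x => by
      by_cases hx : x ∈ tsupport φ
      · have hρx : 0 < ρ x := (hρ0 x).lt_of_ne' (hφ.support hx)
        have hy := mul_le_mul_of_nonneg_left (young_rpow_weight (α := α) hp hρx (abs_nonneg (φ x))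
          -- Since `b = a - 2m`, putting `V^(-2m)` into `q` leaves the common factor `V^a`, and `q ^
          -- p` accounts for the exponent `a - 2mp`.
          (q := Real.exp (u x) ^ (-2 * m) * |(inner ℝ (G x) (gradient φ x) : ℝ)|)
          (by positivity) ht0) (Real.rpow_nonneg (Real.exp_pos (u x)).le a)
        rw [Real.mul_rpow (by positivity) (abs_nonneg _), ← Real.rpow_mul (Real.exp_pos _).le] at hy
        have e1 : Real.exp (u x) ^ b = Real.exp (u x) ^ a * Real.exp (u x) ^ (-2 * m) := by
          rw [← Real.rpow_add (Real.exp_pos _)]; congr 1; linarith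
        have e2 : Real.exp (u x) ^ (a - 2 * m * p) =
            Real.exp (u x) ^ a * Real.exp (u x) ^ (-2 * m * p) := by
          rw [← Real.rpow_add (Real.exp_pos _)]; congr 1; ring
        simp only [Pi.add_apply]
        rw [e1, e2]
        linear_combination hy
      · simp [image_eq_zero_of_notMem_tsupport hx, gradient_eq_zero_of_notMem_tsupport hx, hp0.ne']
  rw [integral_const_mul] at hle
  have hsum : ∫ x, ((fun x => (p - 1) * t ^ p * (ρ x ^ α * Real.exp (u x) ^ a * |φ x| ^ p)) +
      fun x => ρ x ^ (α + p) * Real.exp (u x) ^ (a - 2 * m * p) *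
      |(inner ℝ (G x) (gradient φ x) : ℝ)| ^ p) x ∂riemannianVolume n M = _ :=
    integral_add (hi1.const_mul ((p - 1) * t ^ p)) hi3
  rw [hsum, integral_const_mul] at hle
  rw [hct, mul_assoc] at h1
  -- With `A` the integral of `ρ^α V^a |φ|^p` and `D` the gradient integral, this leads to `p t^p A
  -- ≤ (p - 1) t^p A + D`, hence `t^p A ≤ D`.
  have h2 := mul_le_mul_of_nonneg_left (le_of_mul_le_mul_left h1 hp0)
    (by positivity : 0 ≤ p * t ^ (p - 1))
  have e3 : t ^ p = t ^ (p - 1) * t := by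
    rw [← Real.rpow_add_one ht0.ne']; congr 1; ring
  have h3 := h2.trans hle
  rw [e3] at h3 ⊢
  linear_combination h3

/-- Translates the distributional hypothesis, tested on `V^τ ζ`, into a sign of the form at `β = 0`.
-/
theorem hardyForm_zero_eq (hu : ContMDiff (𝓡 n) 𝓘(ℝ, ℝ) ∞ u) (hρ : Continuous ρ)
    (hG : HasWeakGradient ρ G) {lam mu tau : ℝ} (htau : tau = (n + 1) * lam + mu)
    (hGm : ∀ᵐ x ∂riemannianVolume n M, ‖G x‖ = Real.exp (u x) ^ m) (C : ℝ) {ζ : M → ℝ}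
    (hζ : IsTestFunction n ρ ζ) :
    hardyForm u ρ G (tau + lam - mu) (tau + mu - lam) C 0 ζ =
      ∫ x, C / ρ x * Real.exp (u x) ^ (lam - mu) * (Real.exp (u x) ^ tau * ζ x)
        ∂riemannianVolume n M -
      affineLaplacian u lam mu G (fun x => Real.exp (u x) ^ tau * ζ x) := by
  rw [affineLaplacian_exp_rpow_mul hu htau hG (contMDiff_exp_rpow hu m).continuous
    (hGm.mono fun _ h => h.le) hζ, sub_neg_eq_add, hardyForm,
    integral_add (integrable_hardyForm_left hu hρ C _ _ hζ)
      (integrable_hardyForm_right hu hρ hG hGm 0 _ hζ)]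
  congr 1
  · refine integral_congr_ae (ae_of_all _ fun x => ?_)
    have e : Real.exp (u x) ^ (tau + lam - mu) =
        Real.exp (u x) ^ (lam - mu) * Real.exp (u x) ^ tau := by
      rw [← Real.rpow_add (Real.exp_pos _)]; congr 1; ring
    simp only [zero_sub, Real.rpow_neg_one, e]
    ring
  · simp only [Real.rpow_zero, one_mul]

end HardyInequality

end AffineHardy

/-! ### The inequality in terms of affine gradients. -/

theorem mainTheorem6 {n : ℕ} {M : Type*} [TopologicalSpace M] [T2Space M]
    [SecondCountableTopology M] [ChartedSpace (EuclideanSpace ℝ (Fin n)) M] [IsManifold (𝓡 n) ∞ M]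
    [RiemannianBundle (fun x : M => TangentSpace (𝓡 n) x)]
    [IsContMDiffRiemannianBundle (𝓡 n) ∞ (EuclideanSpace ℝ (Fin n))
      (fun x : M => TangentSpace (𝓡 n) x)]
    [MeasurableSpace M] [BorelSpace M]
    (u : M → ℝ) (hu : ContMDiff (𝓡 n) 𝓘(ℝ, ℝ) ∞ u) (V : M → ℝ) (hV : ∀ x, V x = Real.exp (u x))
    (lam mu tau : ℝ) (htau : tau = (n + 1) * lam + mu)
    (ρ : M → ℝ) (hρ_cont : Continuous ρ) (hρ_nonneg : ∀ x, 0 ≤ ρ x)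
    (G : (x : M) → TangentSpace (𝓡 n) x) (hG : AffineHardy.HasWeakGradient ρ G)
    (hG_norm : ∀ᵐ x ∂(AffineHardy.riemannianVolume n M),
      ‖AffineHardy.affineGradient u lam mu G x‖ = 1)
    (p α C : ℝ) (hp : 1 < p) (hC : 0 < C)
    (φ : M → ℝ) (hφ : AffineHardy.IsTestFunction n ρ φ) :
    Integrable (fun x => ρ x ^ (α + p) *
      |inner ℝ (AffineHardy.affineGradient u lam mu G x)
        (AffineHardy.affineGradient u lam mu (AffineHardy.gradient φ) x)| ^ p *
      V x ^ (tau + lam - mu)) (AffineHardy.riemannianVolume n M) ∧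
    Integrable (fun x => ρ x ^ α * |φ x| ^ p * V x ^ (tau + lam - mu))
      (AffineHardy.riemannianVolume n M) ∧
    (AffineHardy.AffineLaplacianLE u lam mu ρ G (fun x => C / ρ x * V x ^ (lam - mu)) →
      C + α + 1 < 0 →
      (|C + α + 1| / p) ^ p *
          ∫ x, ρ x ^ α * |φ x| ^ p * V x ^ (tau + lam - mu) ∂(AffineHardy.riemannianVolume n M) ≤
        ∫ x, ρ x ^ (α + p) *
          |inner ℝ (AffineHardy.affineGradient u lam mu G x)
            (AffineHardy.affineGradient u lam mu (AffineHardy.gradient φ) x)| ^ p *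
          V x ^ (tau + lam - mu) ∂(AffineHardy.riemannianVolume n M)) ∧
    (AffineHardy.AffineLaplacianGE u lam mu ρ G (fun x => C / ρ x * V x ^ (lam - mu)) →
      0 < C + α + 1 →
      ((C + α + 1) / p) ^ p *
          ∫ x, ρ x ^ α * |φ x| ^ p * V x ^ (tau + lam - mu) ∂(AffineHardy.riemannianVolume n M) ≤
        ∫ x, ρ x ^ (α + p) *
          |inner ℝ (AffineHardy.affineGradient u lam mu G x)
            (AffineHardy.affineGradient u lam mu (AffineHardy.gradient φ) x)| ^ p *
          V x ^ (tau + lam - mu) ∂(AffineHardy.riemannianVolume n M)) := by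
  obtain rfl : V = fun x => Real.exp (u x) := funext hV
  have hp0 : 0 < p := by linarith
  have hGm : ∀ᵐ x ∂(AffineHardy.riemannianVolume n M), ‖G x‖ = Real.exp (u x) ^ (lam - mu) :=
    hG_norm.mono fun x hx => AffineHardy.norm_eq_of_norm_affineGradient hx
  have hL : ∀ x, ρ x ^ α * |φ x| ^ p * Real.exp (u x) ^ (tau + lam - mu) =
      ρ x ^ α * Real.exp (u x) ^ (tau + lam - mu) * |φ x| ^ p := fun x => by ring
  -- Each of the two affine gradients contributes `V^(μ-λ)`, so the `p`-th power contributes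
  -- `V^(-2mp)` with `m = λ - μ`.
  have hR : ∀ x, ρ x ^ (α + p) *
      |inner ℝ (AffineHardy.affineGradient u lam mu G x)
        (AffineHardy.affineGradient u lam mu (AffineHardy.gradient φ) x)| ^ p *
      Real.exp (u x) ^ (tau + lam - mu) =
      ρ x ^ (α + p) * Real.exp (u x) ^ (tau + lam - mu - 2 * (lam - mu) * p) *
        |inner ℝ (G x) (AffineHardy.gradient φ x)| ^ p := fun x => by
    have hw := Real.rpow_pos_of_pos (Real.exp_pos (u x)) (mu - lam)
    rw [AffineHardy.affineGradient, AffineHardy.affineGradient, real_inner_smul_left,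
      real_inner_smul_right, abs_mul, abs_mul, abs_of_pos hw, Real.mul_rpow hw.le (by positivity),
      Real.mul_rpow hw.le (abs_nonneg _), ← Real.rpow_mul (Real.exp_pos _).le]
    have e : Real.exp (u x) ^ (tau + lam - mu - 2 * (lam - mu) * p) =
        Real.exp (u x) ^ ((mu - lam) * p) * Real.exp (u x) ^ ((mu - lam) * p) *
          Real.exp (u x) ^ (tau + lam - mu) := by
      rw [← Real.rpow_add (Real.exp_pos _), ← Real.rpow_add (Real.exp_pos _)]; congr 1; ring
    rw [e]
    ring
  simp only [hL, hR]
  refine ⟨?_, AffineHardy.integrable_weight_mul_abs_rpow hu hρ_cont α _ hp0 hφ,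
    fun h hc => ?_, fun h hc => ?_⟩
  · simpa using AffineHardy.integrable_weight_mul_abs_inner_gradient_rpow hu hρ_cont hG hGm (α + p)
      (tau + lam - mu - 2 * (lam - mu) * p) hp0 le_rfl hφ
  -- An upper bound on `Δ^D ρ` makes the form nonnegative, so `σ = 1`, which matches `C + α + 1 <
  -- 0`; in the other case both signs are reversed.
  · refine AffineHardy.hardy_of_hardyForm_nonneg hu hρ_cont hρ_nonneg hG hGm
      (b := tau + mu - lam) (by ring) (σ := 1) hp (by simp) (by rw [abs_of_neg hc]; ring) hc.ne
      (fun ζ hζ hζ0 => ?_) hφ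
    have := h _ (hζ.exp_rpow_mul hu tau)
      fun x => mul_nonneg (Real.rpow_nonneg (Real.exp_pos _).le _) (hζ0 x)
    rw [AffineHardy.hardyForm_zero_eq hu hρ_cont hG htau hGm C hζ]
    linarith
  · have key := AffineHardy.hardy_of_hardyForm_nonneg hu hρ_cont hρ_nonneg hG hGm
      (a := tau + lam - mu) (b := tau + mu - lam) (by ring) (σ := -1) (C := C) (α := α) hp (by simp)
      (by rw [abs_of_pos hc]; ring) hc.ne' (fun ζ hζ hζ0 => ?_) hφ
    · rwa [abs_of_pos hc] at key
    have := h _ (hζ.exp_rpow_mul hu tau)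
      fun x => mul_nonneg (Real.rpow_nonneg (Real.exp_pos _).le _) (hζ0 x)
    rw [AffineHardy.hardyForm_zero_eq hu hρ_cont hG htau hGm C hζ]
    linarith
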